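/- Let $g,n\ge 0$ be integers with $3g-3+n>0$. A stable graph of type $(g,n)$ is a connected finite graph $G$ (loops and multiple edges allowed) with vertex weights $w:V(G)\to\mathbb{Z}_{\ge0}$ and a marking $m:\{1,\dots,n\}\to V(G)$ such that $|E(G)|-|V(G)|+1+\sum_v w(v)=g$ and $2w(v)-2+\operatorname{val}(v)+|m^{-1}(v)|>0$ for every vertex $v$. Morphisms of stable graphs are composites of isomorphisms and edge contractions (contracting a loop raises the weight of its vertex by one, contracting a non-loop edge adds the weights of its end points); a morphism $f:G\to G'$ induces an injection $f^*:E(G')\to E(G)$. * $\Delta_{g,n}$ is the symmetric $\Delta$-complex, i.e. the functor from the opposite of the category of the finite sets $[p]=\{0,\dots,p\}$ ($p\ge-1$, $[-1]=\varnothing$) and injections to sets, with $\Delta_{g,n}[p]$ the set of isomorphism classes $[G,\tau]$ of stable graphs $G$ of type $(g,n)$ with a bijection $\tau:E(G)\to[p]$. An injection $\iota:[p]\to[q]$ sends $[G,\tau]\in\Delta_{g,n}[q]$ to the class of the graph obtained by contracting all edges with label outside $\iota([p])$, with labels pulled back along $\iota$. $\operatorname{Aut}(\Delta_{g,n})$ is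 its group of natural automorphisms. * $M^{\mathrm{trop}}_{g,n}$ is the generalized cone complex given as the colimit of the cones $\mathbb{R}_{\ge0}^{E(G)}$ (integral structure $\mathbb{Z}^{E(G)}$) over all stable graphs $G$ of type $(g,n)$, along the face maps $\mathbb{R}_{\ge0}^{E(G')}\to\mathbb{R}_{\ge0}^{E(G)}$ (extension by zero along $f^*$) for all morphisms $f:G\to G'$. $\overline{M}^{\mathrm{trop}}_{g,n}$ is the extended generalized cone complex obtained in the same way from the extended cones $[0,\infty]^{E(G)}$. * A morphism of generalized cone complexes is a continuous map such that its composite with the canonical map of every cone of the source factors through a morphism to some cone of the target; a map $\mathbb{R}_{\ge0}^A\to\mathbb{R}_{\ge0}^B$ is a morphism of cones if each of its coordinates is a linear form with coefficients in $\mathbb{Z}_{\ge0}$. The extended case is the same, with a map $[0,\infty]^A\to[0,\infty]^B$ being a morphism if each coordinate is either such a linear form (with $0\cdot\infty=0$) or constantly $\infty$. Automorphisms of $M^{\mathrm{trop}}_{g,n}$ and $\overline{M}^{\mathrm{trop}}_{g,n}$ are taken in these categories. Then there are canonical isomorphisms of groups $$\operatorname{Aut}(\overline{M}^{\mathrm{trop}}_{g,n})\cong\operatorname{Aut}(M^{\mathrm{trop}}_{g,n})\cong\operatorname{Aut}(\Delta_{g,n}).$$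 Precisely: (1) there is a unique group isomorphism $\Theta:\operatorname{Aut}(\overline{M}^{\mathrm{trop}}_{g,n})\to\operatorname{Aut}(M^{\mathrm{trop}}_{g,n})$ such that every $\psi\in\operatorname{Aut}(\overline{M}^{\mathrm{trop}}_{g,n})$ restricts to $\Theta(\psi)$ along the inclusion $M^{\mathrm{trop}}_{g,n}\to\overline{M}^{\mathrm{trop}}_{g,n}$; (2) there is a unique group isomorphism $\Psi:\operatorname{Aut}(M^{\mathrm{trop}}_{g,n})\to\operatorname{Aut}(\Delta_{g,n})$ such that for every $\varphi\in\operatorname{Aut}(M^{\mathrm{trop}}_{g,n})$, $p\ge-1$, $\sigma\in\Delta_{g,n}[p]$ and $a\in\mathbb{R}_{\ge0}^{[p]}$ one has $\varphi(\langle\sigma,a\rangle)=\langle\Psi(\varphi)(\sigma),a\rangle$, where $\langle[G,\tau],a\rangle\in M^{\mathrm{trop}}_{g,n}$ denotes the point given by $G$ with edge lengths $a\circ\tau$. -/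

import Mathlib

open CategoryTheory Opposite
open scoped NNReal ENNReal

namespace TropModuli

/-- A finite graph given by its set `X = V ⊔ H` of vertices and half-edges; `r` sends a half-edge to
the vertex it is incident to, `s` exchanges the two halves of an edge, and the vertices are the common
fixed points of `r` and `s`. Loops and multiple edges are allowed. -/
structure HalfEdgeGraph where
  X : Type
  finite : Finite X
  s : X → X
  r : X → X
  s_s : ∀ x, s (s x) = x
  r_r : ∀ x, r (r x) = r x
  r_eq_iff : ∀ x, r x = x ↔ s x = x

namespace HalfEdgeGraph

variable (G : HalfEdgeGraph)

/-- Vertices. -/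
abbrev V : Type := {x : G.X // G.s x = x}

/-- Half-edges. -/
abbrev H : Type := {x : G.X // G.s x ≠ x}

instance : Finite G.X := G.finite
noncomputable instance : Fintype G.X := Fintype.ofFinite _
noncomputable instance : Fintype G.V := Fintype.ofFinite _
noncomputable instance : Fintype G.H := Fintype.ofFinite _

/-- The other half of the edge that contains a half-edge. -/
def sH (h : G.H) : G.H := ⟨G.s h.1, fun e => h.2 (by rw [G.s_s] at e; exact e.symm)⟩

/-- The vertex to which a half-edge is incident. -/
def rH (h : G.H) : G.V := ⟨G.r h.1, (G.r_eq_iff _).1 (G.r_r _)⟩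

/-- Two half-edges are equivalent if they are halves of the same edge. -/
def edgeSetoid : Setoid G.H where
  r h k := k = h ∨ k = G.sH h
  iseqv :=
    { refl := fun _ => Or.inl rfl
      symm := by
        rintro h k (rfl | rfl)
        · exact Or.inl rfl
        · exact Or.inr (Subtype.ext (G.s_s _).symm)
      trans := by
        rintro h k l (rfl | rfl) (rfl | rfl)
        · exact Or.inl rfl
        · exact Or.inr rfl
        · exact Or.inr rfl
        · exact Or.inl (Subtype.ext (G.s_s _)) }

/-- Edges: half-edges modulo `h ~ s h`. -/
abbrev E : Type := Quotient G.edgeSetoid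

noncomputable instance : Fintype G.E := Fintype.ofFinite _

/-- The edge that contains a given half-edge. -/
def edge (h : G.H) : G.E := Quotient.mk _ h

/-- The graph is nonempty and connected: any two elements of `X` are joined by a chain of
incidences `x - r x` and `x - s x`. -/
def Connected : Prop :=
  Nonempty G.X ∧ ∀ x y : G.X, Relation.EqvGen (fun a b => b = G.r a ∨ b = G.s a) x y

/-- The genus of a connected graph with vertex weights `w`: the first Betti number `|E| - |V| + 1` plus
the sum of the weights. -/
noncomputable def genus (w : G.V → ℕ) : ℤ :=
  (Nat.card G.E : ℤ) - Nat.card G.V + 1 + ∑ v, (w v : ℤ)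

end HalfEdgeGraph

/-- A stable `n`-marked weighted graph of genus `g`. -/
structure StableGraph (g n : ℕ) extends HalfEdgeGraph where
  w : toHalfEdgeGraph.V → ℕ
  m : Fin n → toHalfEdgeGraph.V
  connected : toHalfEdgeGraph.Connected
  genus_eq : toHalfEdgeGraph.genus w = g
  stable : ∀ v, 0 < 2 * (w v : ℤ) - 2 + Nat.card {h // toHalfEdgeGraph.rH h = v}
    + Nat.card {i // m i = v}

variable {g n : ℕ}

open scoped Classical in
/-- Morphisms of stable graphs, i.e. composites of isomorphisms and contractions of edges, described
as maps `f : X(G) → X(G')`: `f` is compatible with `r`, `s` and the markings; every half-edge of `G'`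
has exactly one preimage; the preimage of every vertex `v'` is a (nonempty) connected subgraph, and
the weight of `v'` is the first Betti number `|H|/2 - |V| + 1` of that subgraph plus the sum of its vertex
weights (the equation below is twice this one). -/
structure IsMor {G G' : StableGraph g n} (f : G.X → G'.X) : Prop where
  map_r : ∀ x, f (G.r x) = G'.r (f x)
  map_s : ∀ x, f (G.s x) = G'.s (f x)
  map_m : ∀ i, f (G.m i).1 = (G'.m i).1
  existsUnique_half : ∀ h' : G'.H, ∃! x : G.X, f x = h'.1
  fiber_nonempty : ∀ v' : G'.V, ∃ x, f x = v'.1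
  fiber_connected : ∀ (v' : G'.V) (x y : G.X), f x = v'.1 → f y = v'.1 →
    Relation.EqvGen (fun a b => f a = v'.1 ∧ (b = G.r a ∨ b = G.s a)) x y
  weight : ∀ v' : G'.V, 2 * (G'.w v' : ℤ) - 2 =
    ∑ v : G.V with f v.1 = v'.1, (2 * (G.w v : ℤ) - 2) + Nat.card {h : G.H // f h.1 = v'.1}

/-- Isomorphisms of stable graphs. -/
structure IsIsom {G G' : StableGraph g n} (f : G.X → G'.X) : Prop where
  bijective : Function.Bijective f
  map_r : ∀ x, f (G.r x) = G'.r (f x)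
  map_s : ∀ x, f (G.s x) = G'.s (f x)
  map_m : ∀ i, f (G.m i).1 = (G'.m i).1
  weight : ∀ (v : G.V) (v' : G'.V), f v.1 = v'.1 → G'.w v' = G.w v

namespace IsMor

variable {G G' G'' : StableGraph g n} {f : G.X → G'.X} {f' : G'.X → G''.X}

/-- The half-edge of `G` over a half-edge of `G'`. -/
noncomputable def pullH (hf : IsMor f) (h' : G'.H) : G.H :=
  ⟨(hf.existsUnique_half h').choose, fun e => h'.2 (by
    have h1 := (hf.existsUnique_half h').choose_spec.1
    have h2 := hf.map_s (hf.existsUnique_half h').choose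
    rw [e] at h2
    simp only at h1
    rw [h1] at h2
    exact h2.symm)⟩

theorem map_pullH (hf : IsMor f) (h' : G'.H) : f (hf.pullH h').1 = h'.1 :=
  (hf.existsUnique_half h').choose_spec.1

theorem pullH_unique (hf : IsMor f) (h' : G'.H) (h : G.H) (e : f h.1 = h'.1) : hf.pullH h' = h :=
  Subtype.ext ((hf.existsUnique_half h').unique (hf.map_pullH h') e)

theorem pullH_sH (hf : IsMor f) (h' : G'.H) : hf.pullH (G'.sH h') = G.sH (hf.pullH h') := by
  apply hf.pullH_unique
  change f (G.s _) = G'.s _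
  rw [hf.map_s, hf.map_pullH]

/-- The map `f^* : E(G') → E(G)`, sending an edge to its unique preimage. -/
noncomputable def pullE (hf : IsMor f) : G'.E ↪ G.E where
  toFun := Quotient.map hf.pullH (by
    rintro a b (rfl | rfl)
    · exact Or.inl rfl
    · exact Or.inr (hf.pullH_sH a))
  inj' := by
    rintro ⟨a⟩ ⟨b⟩ h
    apply Quotient.sound
    rcases Quotient.exact h with h | h
    · left
      apply Subtype.ext
      rw [← hf.map_pullH, ← hf.map_pullH, h]
    · right
      rw [← hf.pullH_sH] at h
      apply Subtype.ext
      rw [← hf.map_pullH, ← hf.map_pullH, h]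

theorem pullE_edge (hf : IsMor f) (h : G'.H) : hf.pullE (G'.edge h) = G.edge (hf.pullH h) := rfl

theorem range_pullE (hf : IsMor f) (h : G.H) :
    G.edge h ∈ Set.range hf.pullE ↔ G'.s (f h.1) ≠ f h.1 := by
  constructor
  · rintro ⟨⟨k⟩, hk⟩
    have hk : (G.edgeSetoid) (hf.pullH k) h := Quotient.exact hk
    rcases hk with rfl | rfl
    · rw [hf.map_pullH]; exact k.2
    · rw [← hf.pullH_sH, hf.map_pullH]; exact (G'.sH k).2
  · intro h1
    exact ⟨G'.edge ⟨f h.1, h1⟩, by rw [hf.pullE_edge, hf.pullH_unique _ h rfl]⟩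

end IsMor

/-- The contribution `2 w(v) - 2` of a vertex, resp. `1` of a half-edge, to `2 * genus - 2`. -/
noncomputable def chi (G : HalfEdgeGraph) (w : G.V → ℕ) (x : G.X) : ℤ :=
  open scoped Classical in if h : G.s x = x then 2 * (w ⟨x, h⟩ : ℤ) - 2 else 1

open scoped Classical in
theorem sum_chi (G : HalfEdgeGraph) (w : G.V → ℕ) (P : G.X → Prop) :
    ∑ x with P x, chi G w x = ∑ v : G.V with P v.1, (2 * (w v : ℤ) - 2)
      + Nat.card {h : G.H // P h.1} := by
  rw [Finset.sum_filter, ← Fintype.sum_subtype_add_sum_subtype (fun x => G.s x = x), Finset.sum_filter]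
  congr 1
  · refine Finset.sum_congr (by ext; simp) fun v _ => ?_
    split_ifs
    · rw [chi, dif_pos v.2]
    · rfl
  · rw [Nat.card_eq_fintype_card, Fintype.card_subtype, Finset.card_eq_sum_ones, Finset.sum_filter]
    push_cast
    refine Finset.sum_congr (by ext; simp) fun v _ => ?_
    split_ifs
    · rw [chi, dif_neg v.2]
    · rfl

open scoped Classical in
theorem chi_fiber_aux {G G' : HalfEdgeGraph} {w : G.V → ℕ} {w' : G'.V → ℕ} {f : G.X → G'.X}
    (map_s : ∀ x, f (G.s x) = G'.s (f x)) (half : ∀ h' : G'.H, ∃! x : G.X, f x = h'.1)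
    (weight : ∀ v' : G'.V, 2 * (w' v' : ℤ) - 2 =
      ∑ v : G.V with f v.1 = v'.1, (2 * (w v : ℤ) - 2) + Nat.card {h : G.H // f h.1 = v'.1})
    (x' : G'.X) : chi G' w' x' = ∑ x with f x = x', chi G w x := by
  by_cases h : G'.s x' = x'
  · rw [sum_chi, ← weight ⟨x', h⟩, chi, dif_pos h]
  · obtain ⟨x, hx, hu⟩ := half ⟨x', h⟩
    have : (Finset.univ.filter fun y => f y = x') = {x} := by
      ext y
      simp only [Finset.mem_filter, Finset.mem_univ, true_and, Finset.mem_singleton]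
      exact ⟨fun e => hu y e, fun e => e ▸ hx⟩
    rw [this, Finset.sum_singleton, chi, dif_neg h, chi, dif_neg]
    intro e
    have := map_s x
    rw [e] at this
    simp only at hx
    rw [hx] at this
    exact h this.symm

theorem card_H (G : HalfEdgeGraph) : Nat.card G.H = 2 * Nat.card G.E := by
  classical
  rw [Nat.card_eq_fintype_card, Nat.card_eq_fintype_card, ← Finset.card_univ,
    Finset.card_eq_sum_card_fiberwise (f := G.edge) (t := Finset.univ) (by simp),
    Finset.sum_const_nat (m := 2), mul_comm, Finset.card_univ]
  rintro ⟨h⟩ _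
  rw [Finset.card_eq_two]
  refine ⟨h, G.sH h, fun e => h.2 (congrArg Subtype.val e).symm, ?_⟩
  ext k
  simp only [Finset.mem_filter, Finset.mem_univ, true_and, Finset.mem_insert, Finset.mem_singleton]
  constructor
  · intro hk
    exact Quotient.exact hk.symm
  · intro hk
    exact (Quotient.sound (s := G.edgeSetoid) hk).symm

theorem sum_chi_eq_genus (G : HalfEdgeGraph) (w : G.V → ℕ) : ∑ x, chi G w x = 2 * G.genus w - 2 := by
  classical
  have h := sum_chi G w (fun _ => True)
  simp only [Finset.filter_true] at h
  have h1 : Nat.card {h : G.H // True} = Nat.card G.H := Nat.card_congr (Equiv.subtypeUnivEquiv (by simp))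
  rw [h, h1, card_H, Finset.sum_sub_distrib, ← Finset.mul_sum, Finset.sum_const, Finset.card_univ]
  rw [HalfEdgeGraph.genus, Nat.card_eq_fintype_card (α := G.V)]
  push_cast
  simp only [nsmul_eq_mul]
  ring

namespace IsMor

variable {G G' G'' : StableGraph g n} {f : G.X → G'.X} {f' : G'.X → G''.X}

theorem surjective (hf : IsMor f) : Function.Surjective f := fun x' => by
  by_cases h : G'.s x' = x'
  · exact hf.fiber_nonempty ⟨x', h⟩
  · exact (hf.existsUnique_half ⟨x', h⟩).exists

open scoped Classical in
theorem chi_fiber (hf : IsMor f) (x' : G'.X) :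
    chi G'.toHalfEdgeGraph G'.w x' = ∑ x with f x = x', chi G.toHalfEdgeGraph G.w x :=
  chi_fiber_aux hf.map_s hf.existsUnique_half hf.weight x'

theorem comp (hf' : IsMor f') (hf : IsMor f) : IsMor (f' ∘ f) where
  map_r x := by simp [hf.map_r, hf'.map_r]
  map_s x := by simp [hf.map_s, hf'.map_s]
  map_m i := by simp [hf.map_m, hf'.map_m]
  existsUnique_half h := by
    refine ⟨(hf.pullH (hf'.pullH h)).1, by simp [hf.map_pullH, hf'.map_pullH], fun y hy => ?_⟩
    have h1 := (hf'.existsUnique_half h).unique hy (hf'.map_pullH h)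
    exact (hf.existsUnique_half (hf'.pullH h)).unique h1 (hf.map_pullH _)
  fiber_nonempty v := (hf'.surjective.comp hf.surjective) v.1
  fiber_connected v x y hx hy := by
    have key : ∀ a' b' : G'.X, Relation.EqvGen (fun a b => f' a = v.1 ∧ (b = G'.r a ∨ b = G'.s a)) a' b' →
        ∀ a b, f' a' = v.1 → f' b' = v.1 → f a = a' → f b = b' → Relation.EqvGen
          (fun a b => f' (f a) = v.1 ∧ (b = G.r a ∨ b = G.s a)) a b := by
      have same : ∀ a b, f a = f b → f' (f a) = v.1 → Relation.EqvGen
          (fun a b => f' (f a) = v.1 ∧ (b = G.r a ∨ b = G.s a)) a b := by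
        intro a b hab ha
        by_cases hv : G'.s (f a) = f a
        · exact Relation.EqvGen.mono (fun c d hcd => ⟨by rw [hcd.1]; exact ha, hcd.2⟩)
            _ _ (hf.fiber_connected ⟨f a, hv⟩ a b rfl hab.symm)
        · rw [(hf.existsUnique_half ⟨f a, hv⟩).unique rfl hab.symm]
          exact Relation.EqvGen.refl _
      intro a' b' h
      induction h with
      | rel a' b' h =>
        rintro a b ha' hb' rfl rfl
        obtain ⟨-, h | h⟩ := h
        · refine .trans _ (G.r a) _ (.rel _ _ ⟨ha', Or.inl rfl⟩) (same _ _ ?_ ?_)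
          · rw [hf.map_r, h]
          · rw [hf.map_r, ← h, hb']
        · refine .trans _ (G.s a) _ (.rel _ _ ⟨ha', Or.inr rfl⟩) (same _ _ ?_ ?_)
          · rw [hf.map_s, h]
          · rw [hf.map_s, ← h, hb']
      | refl a' =>
        rintro a b ha' hb' rfl h
        exact same _ _ h.symm ha'
      | symm a' b' _ ih =>
        intro a b ha' hb' ha hb
        exact (ih b a hb' ha' hb ha).symm
      | trans a' b' c' h1 h2 ih1 ih2 =>
        intro a c ha' hc' ha hc
        have hb' : f' b' = v.1 := by
          have : ∀ p q, Relation.EqvGen (fun a b => f' a = v.1 ∧ (b = G'.r a ∨ b = G'.s a)) p q →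
              (f' p = v.1 ↔ f' q = v.1) := by
            intro p q h
            induction h with
            | rel p q h =>
              obtain ⟨h0, h | h⟩ := h
              · rw [h, hf'.map_r, h0]; simp [(G''.r_eq_iff v.1).2 v.2]
              · rw [h, hf'.map_s, h0]; simp [v.2]
            | refl => rfl
            | symm _ _ _ ih => exact ih.symm
            | trans _ _ _ _ _ ih1 ih2 => exact ih1.trans ih2
          exact (this _ _ h1).1 ha'
        obtain ⟨b, hb⟩ := hf.surjective b'
        exact (ih1 a b ha' hb' ha hb).trans _ _ _ (ih2 b c hb' hc' hb hc)
    exact key (f x) (f y) (hf'.fiber_connected v _ _ hx hy) x y hx hy rfl rfl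
  weight v := by
    classical
    have h1 : chi G''.toHalfEdgeGraph G''.w v.1 = 2 * (G''.w v : ℤ) - 2 := by rw [chi, dif_pos v.2]
    rw [← h1, hf'.chi_fiber]
    have h2 := sum_chi G.toHalfEdgeGraph G.w (fun x => (f' ∘ f) x = v.1)
    rw [← h2]
    rw [← Finset.sum_fiberwise_of_maps_to (g := f) (s := Finset.univ.filter fun x => (f' ∘ f) x = v.1)
      (t := Finset.univ.filter fun x => f' x = v.1) (by simp)]
    refine Finset.sum_congr rfl fun x' hx' => ?_
    rw [hf.chi_fiber]
    refine Finset.sum_congr ?_ fun _ _ => rfl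
    ext x
    simp only [Finset.mem_filter, Finset.mem_univ, true_and, Function.comp] at hx' ⊢
    constructor
    · intro h; exact ⟨by rw [h, hx'], h⟩
    · exact fun h => h.2

theorem pullE_comp (hf' : IsMor f') (hf : IsMor f) (e : G''.E) :
    (hf'.comp hf).pullE e = hf.pullE (hf'.pullE e) := by
  induction e using Quotient.inductionOn with | h k => ?_
  change G.edge _ = G.edge _
  congr 1
  apply pullH_unique
  simp [map_pullH]

end IsMor

theorem IsIsom.isMor {G G' : StableGraph g n} {f : G.X → G'.X} (hf : IsIsom f) : IsMor f where
  map_r := hf.map_r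
  map_s := hf.map_s
  map_m := hf.map_m
  existsUnique_half h := hf.bijective.existsUnique _
  fiber_nonempty v := hf.bijective.2 _
  fiber_connected v x y hx hy := by
    rw [hf.bijective.1 (hx.trans hy.symm)]
    exact .refl _
  weight v' := by
    classical
    obtain ⟨x, hx⟩ := hf.bijective.2 v'.1
    have hsx : G.s x = x := hf.bijective.1 (by rw [hf.map_s, hx, v'.2])
    have h1 : (Finset.univ.filter fun v : G.V => f v.1 = v'.1) = {⟨x, hsx⟩} := by
      ext v
      simp only [Finset.mem_filter, Finset.mem_univ, true_and, Finset.mem_singleton]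
      constructor
      · intro h; exact Subtype.ext (hf.bijective.1 (h.trans hx.symm))
      · rintro rfl; exact hx
    have h2 : IsEmpty {h : G.H // f h.1 = v'.1} := by
      refine ⟨fun h => h.1.2 ?_⟩
      rw [hf.bijective.1 (h.2.trans hx.symm), hsx]
    rw [h1, Finset.sum_singleton, hf.weight ⟨x, hsx⟩ v' hx]
    simp

theorem IsMor.isIsom {G G' : StableGraph g n} {f : G.X → G'.X} (hf : IsMor f)
    (hb : Function.Bijective f) : IsIsom f where
  bijective := hb
  map_r := hf.map_r
  map_s := hf.map_s
  map_m := hf.map_m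
  weight v v' h := by
    classical
    have h0 := hf.chi_fiber v'.1
    have h1 : (Finset.univ.filter fun x : G.X => f x = v'.1) = {v.1} := by
      ext x
      simp only [Finset.mem_filter, Finset.mem_univ, true_and, Finset.mem_singleton]
      constructor
      · intro h'; exact hb.1 (h'.trans h.symm)
      · rintro rfl; exact h
    simp only [h1, Finset.sum_singleton, chi, v.2, v'.2, dite_true, Subtype.coe_eta] at h0
    have : (G'.w v' : ℤ) = G.w v := by linarith
    exact_mod_cast this


theorem HalfEdgeGraph.Connected.card_V_le {G : HalfEdgeGraph} (hG : G.Connected) :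
    Nat.card G.V ≤ Nat.card G.E + 1 := by
  classical
  let ends : G.E → Sym2 G.V := Quotient.lift (fun h => s(G.rH h, G.rH (G.sH h))) (by
    rintro a b (rfl | rfl)
    · rfl
    · have : G.sH (G.sH a) = a := Subtype.ext (G.s_s _)
      simp only [this]
      exact Sym2.eq_swap)
  let Q : SimpleGraph G.V := SimpleGraph.fromRel fun u v => ∃ h, G.rH h = u ∧ G.rH (G.sH h) = v
  have hQ : Q.edgeSet ⊆ Set.range ends := by
    intro e
    induction e using Sym2.ind with | _ u v => ?_
    rintro ⟨-, ⟨h, rfl, rfl⟩ | ⟨h, rfl, rfl⟩⟩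
    · exact ⟨G.edge h, rfl⟩
    · exact ⟨G.edge h, Sym2.eq_swap⟩
  have hr : ∀ x, G.s (G.r x) = G.r x := fun x => (G.r_eq_iff _).1 (G.r_r x)
  have key : ∀ x y, Relation.EqvGen (fun a b => b = G.r a ∨ b = G.s a) x y →
      Q.Reachable ⟨G.r x, hr x⟩ ⟨G.r y, hr y⟩ := by
    intro x y h
    induction h with
    | rel a b h =>
      obtain rfl | rfl := h
      · simp only [G.r_r]; rfl
      · by_cases ha : G.s a = a
        · simp only [ha]; rfl
        by_cases hab : G.r a = G.r (G.s a)
        · simp only [← hab]; rfl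
        · refine SimpleGraph.Adj.reachable ⟨?_, Or.inl ⟨⟨a, ha⟩, rfl, rfl⟩⟩
          exact fun e => hab (congrArg Subtype.val e)
    | refl => rfl
    | symm _ _ _ ih => exact ih.symm
    | trans _ _ _ _ _ ih1 ih2 => exact ih1.trans ih2
  have hconn : Q.Connected := by
    have : Nonempty G.V := ⟨⟨G.r hG.1.some, hr _⟩⟩
    refine ⟨fun u v => ?_⟩
    have := key u.1 v.1 (hG.2 _ _)
    simpa only [(G.r_eq_iff _).2 u.2, (G.r_eq_iff _).2 v.2] using this
  have h1 := hconn.card_vert_le_card_edgeSet_add_one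
  have h2 : Nat.card Q.edgeSet ≤ Nat.card (Set.range ends) :=
    Nat.card_mono (Set.toFinite _) hQ
  have h3 : Nat.card (Set.range ends) ≤ Nat.card G.E :=
    Nat.card_le_card_of_surjective _ Set.rangeFactorization_surjective
  omega

/-- The relation generating the identifications made when the edges in `S` are contracted: both
halves of a contracted edge are identified with their end points. -/
def contractRel (G : HalfEdgeGraph) (S : Set G.E) (a b : G.X) : Prop :=
  ∃ h : G.s a ≠ a, G.edge ⟨a, h⟩ ∈ S ∧ (b = G.r a ∨ b = G.s a)

/-- The elements of `X(G)` that become vertices when the edges in `S` are contracted. -/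
def Collapsed (G : HalfEdgeGraph) (S : Set G.E) (x : G.X) : Prop :=
  ∀ h : G.s x ≠ x, G.edge ⟨x, h⟩ ∈ S

section contract

variable {G : HalfEdgeGraph} {S : Set G.E}

theorem edge_sH (h : G.H) : G.edge (G.sH h) = G.edge h :=
  (Quotient.sound (s := G.edgeSetoid) (Or.inr rfl)).symm

theorem collapsed_of_vertex {x : G.X} (h : G.s x = x) : Collapsed G S x := fun h' => (h' h).elim

theorem collapsed_r (x : G.X) : Collapsed G S (G.r x) :=
  collapsed_of_vertex ((G.r_eq_iff _).1 (G.r_r x))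

theorem collapsed_s {x : G.X} (h : Collapsed G S x) : Collapsed G S (G.s x) := by
  intro h'
  have h0 : G.s x ≠ x := fun e => h' (by rw [e, e])
  exact (edge_sH ⟨x, h0⟩) ▸ h h0

theorem contractRel.collapsed {a b : G.X} (h : contractRel G S a b) :
    Collapsed G S a ∧ Collapsed G S b := by
  obtain ⟨h0, h1, h2⟩ := h
  have ha : Collapsed G S a := fun _ => h1
  refine ⟨ha, ?_⟩
  rcases h2 with rfl | rfl
  · exact collapsed_r a
  · exact collapsed_s ha

theorem eq_or_collapsed {a b : G.X} (h : Quot.mk (contractRel G S) a = Quot.mk _ b) :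
    a = b ∨ (Collapsed G S a ∧ Collapsed G S b) := by
  have h' := Quot.eqvGen_exact h
  clear h
  induction h' with
  | rel a b h => exact Or.inr h.collapsed
  | refl => exact Or.inl rfl
  | symm a b h ih => exact ih.imp Eq.symm And.symm
  | trans a b c h1 h2 ih1 ih2 =>
    rcases ih1 with rfl | h3
    · exact ih2
    · rcases ih2 with rfl | h4
      · exact Or.inr h3
      · exact Or.inr ⟨h3.1, h4.2⟩

theorem Collapsed.mk_r {x : G.X} (h : Collapsed G S x) :
    Quot.mk (contractRel G S) (G.r x) = Quot.mk _ x := by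
  by_cases hx : G.s x = x
  · rw [(G.r_eq_iff x).2 hx]
  · exact (Quot.sound ⟨hx, h hx, Or.inl rfl⟩).symm

theorem Collapsed.mk_s {x : G.X} (h : Collapsed G S x) :
    Quot.mk (contractRel G S) (G.s x) = Quot.mk _ x := by
  by_cases hx : G.s x = x
  · rw [hx]
  · exact (Quot.sound ⟨hx, h hx, Or.inr rfl⟩).symm

theorem mk_s_eq_iff {x : G.X} : Quot.mk (contractRel G S) (G.s x) = Quot.mk _ x ↔ Collapsed G S x := by
  refine ⟨fun h => ?_, Collapsed.mk_s⟩
  rcases eq_or_collapsed h with h | h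
  · exact collapsed_of_vertex h
  · exact h.2

theorem mk_r_eq_iff {x : G.X} : Quot.mk (contractRel G S) (G.r x) = Quot.mk _ x ↔ Collapsed G S x := by
  refine ⟨fun h => ?_, Collapsed.mk_r⟩
  rcases eq_or_collapsed h with h | h
  · exact h ▸ collapsed_r x
  · exact h.2

variable (G S)

/-- The underlying graph of `G/S`. -/
def contractGraph : HalfEdgeGraph where
  X := Quot (contractRel G S)
  finite := inferInstance
  s := Quot.lift (fun x => Quot.mk _ (G.s x)) (fun a b h => by
    rw [h.collapsed.1.mk_s, h.collapsed.2.mk_s]; exact Quot.sound h)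
  r := Quot.lift (fun x => Quot.mk _ (G.r x)) (fun a b h => by
    rw [h.collapsed.1.mk_r, h.collapsed.2.mk_r]; exact Quot.sound h)
  s_s := by rintro ⟨x⟩; exact congrArg (Quot.mk _) (G.s_s x)
  r_r := by rintro ⟨x⟩; exact congrArg (Quot.mk _) (G.r_r x)
  r_eq_iff := by rintro ⟨x⟩; exact mk_r_eq_iff.trans mk_s_eq_iff.symm

/-- The contraction map `X(G) → X(G/S)`. -/
def contractMap (x : G.X) : (contractGraph G S).X := Quot.mk _ x

variable {G S}

theorem collapsed_iff {x : G.X} :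
    (contractGraph G S).s (contractMap G S x) = contractMap G S x ↔ Collapsed G S x :=
  mk_s_eq_iff

theorem collapsed_of_eq {x : G.X} (v : (contractGraph G S).V) (h : contractMap G S x = v.1) :
    Collapsed G S x := collapsed_iff.1 (by rw [h, v.2])

theorem contract_fiber_connected (v : (contractGraph G S).V) (x y : G.X)
    (hx : contractMap G S x = v.1) (hy : contractMap G S y = v.1) :
    Relation.EqvGen (fun a b => contractMap G S a = v.1 ∧ (b = G.r a ∨ b = G.s a)) x y := by
  have h := Quot.eqvGen_exact (hx.trans hy.symm)
  clear hy
  induction h with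
  | rel a b h => exact .rel _ _ ⟨hx, h.choose_spec.2⟩
  | refl => exact .refl _
  | symm a b h ih => exact (ih ((Quot.eqvGen_sound h).trans hx)).symm
  | trans a b c h1 h2 ih1 ih2 =>
    exact (ih1 hx).trans _ _ _ (ih2 ((Quot.eqvGen_sound h1).symm.trans hx))

/-- The subgraph of `G` that is contracted to a vertex `v`. -/
def fiberGraph (v : (contractGraph G S).V) : HalfEdgeGraph where
  X := {x : G.X // contractMap G S x = v.1}
  finite := inferInstance
  s x := ⟨G.s x.1, (collapsed_of_eq v x.2).mk_s.trans x.2⟩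
  r x := ⟨G.r x.1, (collapsed_of_eq v x.2).mk_r.trans x.2⟩
  s_s x := Subtype.ext (G.s_s _)
  r_r x := Subtype.ext (G.r_r _)
  r_eq_iff x := by rw [Subtype.ext_iff, Subtype.ext_iff]; exact G.r_eq_iff _

theorem fiberGraph_connected (v : (contractGraph G S).V) : (fiberGraph v).Connected := by
  refine ⟨?_, ?_⟩
  · obtain ⟨x, hx⟩ := Quot.exists_rep v.1
    exact ⟨⟨x, hx⟩⟩
  · have key : ∀ x y,
        Relation.EqvGen (fun a b => contractMap G S a = v.1 ∧ (b = G.r a ∨ b = G.s a)) x y →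
        (contractMap G S x = v.1 ↔ contractMap G S y = v.1) ∧
        ∀ (hx : contractMap G S x = v.1) (hy : contractMap G S y = v.1),
        Relation.EqvGen (fun a b => b = (fiberGraph v).r a ∨ b = (fiberGraph v).s a)
          (⟨x, hx⟩ : (fiberGraph v).X) (⟨y, hy⟩ : (fiberGraph v).X) := by
      intro x y h
      induction h with
      | rel a b h =>
        refine ⟨⟨fun _ => ?_, fun _ => h.1⟩, fun hx hy => .rel _ _ ?_⟩
        · obtain ⟨h0, rfl | rfl⟩ := h
          · exact (collapsed_of_eq v h0).mk_r.trans h0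
          · exact (collapsed_of_eq v h0).mk_s.trans h0
        · exact h.2.imp Subtype.ext Subtype.ext
      | refl a => exact ⟨Iff.rfl, fun _ _ => .refl _⟩
      | symm a b h ih => exact ⟨ih.1.symm, fun hx hy => (ih.2 hy hx).symm⟩
      | trans a b c h1 h2 ih1 ih2 =>
        exact ⟨ih1.1.trans ih2.1, fun hx hy => (ih1.2 hx (ih1.1.1 hx)).trans _ _ _ (ih2.2 _ hy)⟩
    rintro ⟨x, hx⟩ ⟨y, hy⟩
    exact (key x y (contract_fiber_connected v x y hx hy)).2 hx hy

theorem contractGraph_connected (hG : G.Connected) : (contractGraph G S).Connected := by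
  refine ⟨hG.1.map (contractMap G S), ?_⟩
  rintro ⟨x⟩ ⟨y⟩
  induction hG.2 x y with
  | rel a b h => exact .rel _ _ (h.imp (congrArg _) (congrArg _))
  | refl => exact .refl _
  | symm _ _ _ ih => exact ih.symm
  | trans _ _ _ _ _ ih1 ih2 => exact ih1.trans _ _ _ ih2

end contract

open scoped Classical in
/-- The vertex weights of `G/S`: first Betti number of the contracted connected subgraph plus the sum
of its vertex weights. -/
noncomputable def contractWeight (G : StableGraph g n) (S : Set G.E)
    (v' : (contractGraph G.toHalfEdgeGraph S).V) : ℕ :=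
  (Nat.card (fiberGraph v').E + 1 - Nat.card (fiberGraph v').V)
    + ∑ v : G.V with contractMap G.toHalfEdgeGraph S v.1 = v'.1, G.w v

open scoped Classical in
theorem contractWeight_eq (G : StableGraph g n) (S : Set G.E)
    (v' : (contractGraph G.toHalfEdgeGraph S).V) :
    2 * (contractWeight G S v' : ℤ) - 2 =
    ∑ v : G.V with contractMap G.toHalfEdgeGraph S v.1 = v'.1, (2 * (G.w v : ℤ) - 2)
      + Nat.card {h : G.H // contractMap G.toHalfEdgeGraph S h.1 = v'.1} := by
  have h1 := (fiberGraph_connected v').card_V_le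
  have h2 := card_H (fiberGraph v')
  have h3 : Nat.card (fiberGraph v').H
      = Nat.card {h : G.H // contractMap G.toHalfEdgeGraph S h.1 = v'.1} :=
    Nat.card_congr
      { toFun := fun x => ⟨⟨x.1.1, fun e => x.2 (Subtype.ext e)⟩, x.1.2⟩
        invFun := fun x => ⟨⟨x.1.1, x.2⟩, fun e => x.1.2 (congrArg Subtype.val e)⟩
        left_inv := fun _ => rfl
        right_inv := fun _ => rfl }
  have h4 : Nat.card (fiberGraph v').V
      = (Finset.univ.filter fun v : G.V => contractMap G.toHalfEdgeGraph S v.1 = v'.1).card := by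
    rw [← Fintype.card_subtype, ← Nat.card_eq_fintype_card]
    exact Nat.card_congr
      { toFun := fun x => ⟨⟨x.1.1, congrArg Subtype.val x.2⟩, x.1.2⟩
        invFun := fun x => ⟨⟨x.1.1, x.2⟩, Subtype.ext x.1.2⟩
        left_inv := fun _ => rfl
        right_inv := fun _ => rfl }
  rw [← h3, h2, contractWeight, Finset.sum_sub_distrib, ← Finset.mul_sum, Finset.sum_const, ← h4]
  push_cast [Nat.cast_sub h1]
  simp only [nsmul_eq_mul]
  ring

theorem contract_half {G : HalfEdgeGraph} {S : Set G.E} (h' : (contractGraph G S).H) :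
    ∃! x : G.X, contractMap G S x = h'.1 := by
  obtain ⟨⟨x⟩, hx⟩ := h'
  refine ⟨x, rfl, fun y hy => ?_⟩
  rcases eq_or_collapsed hy with h | h
  · exact h
  · exact (hx (collapsed_iff.2 h.2)).elim

theorem sum_card_fiber {A B : Type*} [Finite A] [Fintype B] (f : A → B) (P : B → Prop)
    [DecidablePred P] : ∑ b with P b, Nat.card {a // f a = b} = Nat.card {a // P (f a)} := by
  classical
  have := Fintype.ofFinite A
  simp only [Nat.card_eq_fintype_card, Fintype.card_subtype]
  rw [Finset.card_eq_sum_card_fiberwise (f := f) (t := Finset.univ.filter P)]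
  · refine Finset.sum_congr rfl fun b hb => ?_
    rw [Finset.filter_filter]
    congr 1
    ext a
    simp only [Finset.mem_filter, Finset.mem_univ, true_and] at hb ⊢
    constructor
    · rintro rfl; exact ⟨hb, rfl⟩
    · exact fun h => h.2
  · intro a ha
    simpa using ha

theorem card_contract_val (G : HalfEdgeGraph) (S : Set G.E) (v' : (contractGraph G S).V) :
    Nat.card {h : G.H // contractMap G S (G.rH h).1 = v'.1}
      = Nat.card {h : G.H // contractMap G S h.1 = v'.1}
        + Nat.card {h' // (contractGraph G S).rH h' = v'} := by
  classical
  have hex : ∀ h' : (contractGraph G S).H, ∃ x, contractMap G S x = h'.1 :=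
    fun h' => (contract_half h').exists
  choose q hq using hex
  have hq1 : ∀ h', G.s (q h') ≠ q h' := fun h' e => h'.2 (by
    rw [← hq h', collapsed_iff]
    exact collapsed_of_vertex e)
  have hq2 : ∀ h', (contractGraph G S).rH h' = v' → contractMap G S (G.r (q h')) = v'.1 := by
    intro h' e
    have h2 : (contractGraph G S).r h'.1 = v'.1 := congrArg Subtype.val e
    rw [← hq h'] at h2
    exact h2
  rw [← Nat.card_sum]
  refine (Nat.card_congr (Equiv.ofBijective (Sum.elim
    (fun h => (⟨h.1, (collapsed_of_eq v' h.2).mk_r.trans h.2⟩ :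
      {h : G.H // contractMap G S (G.rH h).1 = v'.1}))
    (fun h' => ⟨⟨q h'.1, hq1 _⟩, hq2 _ h'.2⟩)) ⟨?_, ?_⟩)).symm
  · rintro (a | a) (b | b) h
    · exact congrArg Sum.inl (Subtype.ext (congrArg (fun z => z.1) h))
    · exfalso
      have h0 : a.1.1 = q b.1 := congrArg (fun z => z.1.1) h
      apply b.1.2
      rw [← hq, ← h0, a.2, v'.2]
    · exfalso
      have h0 : q a.1 = b.1.1 := congrArg (fun z => z.1.1) h
      apply a.1.2
      rw [← hq, h0, b.2, v'.2]
    · have h0 : q a.1 = q b.1 := congrArg (fun z => z.1.1) h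
      exact congrArg Sum.inr (Subtype.ext (Subtype.ext (by rw [← hq, ← hq, h0])))
  · rintro ⟨h, hh⟩
    by_cases hc : contractMap G S h.1 = v'.1
    · exact ⟨Sum.inl ⟨h, hc⟩, rfl⟩
    · have hs : (contractGraph G S).s (contractMap G S h.1) ≠ contractMap G S h.1 := fun e =>
        hc ((collapsed_iff.1 e).mk_r.symm.trans hh)
      refine ⟨Sum.inr ⟨⟨contractMap G S h.1, hs⟩, Subtype.ext hh⟩, ?_⟩
      refine Subtype.ext (Subtype.ext ?_)
      exact (contract_half ⟨contractMap G S h.1, hs⟩).unique (hq _) rfl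

/-- The stable graph `G/S` obtained by contracting a set `S` of edges. -/
noncomputable def contract (G : StableGraph g n) (S : Set G.E) : StableGraph g n where
  toHalfEdgeGraph := contractGraph G.toHalfEdgeGraph S
  w := contractWeight G S
  m i := ⟨contractMap G.toHalfEdgeGraph S (G.m i).1,
    collapsed_iff.2 (collapsed_of_vertex (G.m i).2)⟩
  connected := contractGraph_connected G.connected
  genus_eq := by
    classical
    have h1 := sum_chi_eq_genus _ (contractWeight G S)
    have h2 := sum_chi_eq_genus _ G.w
    rw [G.genus_eq] at h2
    rw [← Finset.sum_fiberwise_of_maps_to (g := contractMap G.toHalfEdgeGraph S)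
      (t := Finset.univ) (by simp)] at h2
    rw [Finset.sum_congr rfl fun x' _ => chi_fiber_aux (f := contractMap G.toHalfEdgeGraph S)
      (fun _ => rfl) contract_half (contractWeight_eq G S) x'] at h1
    have := h1.symm.trans h2
    linarith
  stable v' := by
    classical
    set f := contractMap G.toHalfEdgeGraph S with hf
    have h0 : 0 < ∑ v : G.V with f v.1 = v'.1, (2 * (G.w v : ℤ) - 2 + Nat.card {h // G.rH h = v}
        + Nat.card {i // G.m i = v}) := by
      refine Finset.sum_pos (fun v _ => G.stable v) ?_
      obtain ⟨x, hx⟩ := Quot.exists_rep v'.1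
      refine ⟨⟨G.r x, (G.r_eq_iff _).1 (G.r_r x)⟩, ?_⟩
      simp only [Finset.mem_filter, Finset.mem_univ, true_and]
      exact (collapsed_of_eq v' hx).mk_r.trans hx
    rw [Finset.sum_add_distrib, Finset.sum_add_distrib, ← Nat.cast_sum, ← Nat.cast_sum,
      sum_card_fiber G.rH (fun v => f v.1 = v'.1), sum_card_fiber G.m (fun v => f v.1 = v'.1),
      card_contract_val] at h0
    rw [contractWeight_eq]
    have h3 : Nat.card {i // f (G.m i).1 = v'.1} = Nat.card {i // (⟨f (G.m i).1,
        collapsed_iff.2 (collapsed_of_vertex (G.m i).2)⟩ :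
          (contractGraph G.toHalfEdgeGraph S).V) = v'} :=
      Nat.card_congr (Equiv.subtypeEquivRight fun i =>
        ⟨fun h => Subtype.ext h, fun h => congrArg Subtype.val h⟩)
    rw [← h3]
    push_cast at h0
    linarith

theorem contract_isMor (G : StableGraph g n) (S : Set G.E) :
    IsMor (G' := contract G S) (contractMap G.toHalfEdgeGraph S) where
  map_r _ := rfl
  map_s _ := rfl
  map_m _ := rfl
  existsUnique_half := contract_half
  fiber_nonempty v := Quot.exists_rep v.1
  fiber_connected := contract_fiber_connected
  weight := contractWeight_eq G S

theorem range_pullE_contract (G : StableGraph g n) (S : Set G.E) :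
    Set.range (contract_isMor G S).pullE = Sᶜ := by
  ext ⟨h⟩
  refine ((contract_isMor G S).range_pullE h).trans ?_
  refine (not_congr collapsed_iff).trans (not_congr ?_)
  exact ⟨fun hc => hc h.2, fun hc _ => hc⟩

theorem IsMor.eq_of_eq {G G₁ G₂ : StableGraph g n} {f₁ : G.X → G₁.X} {f₂ : G.X → G₂.X}
    (h₁ : IsMor f₁) (h₂ : IsMor f₂) (hr : Set.range h₁.pullE = Set.range h₂.pullE) (x y : G.X)
    (h : f₁ x = f₁ y) : f₂ x = f₂ y := by
  have hvert : ∀ a, G₁.s (f₁ a) = f₁ a → G₂.s (f₂ a) = f₂ a := by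
    intro a ha
    by_cases hs : G.s a = a
    · rw [← h₂.map_s, hs]
    · by_contra hb
      refine (h₁.range_pullE ⟨a, hs⟩).1 ?_ ha
      rw [hr]
      exact (h₂.range_pullE ⟨a, hs⟩).2 hb
  by_cases hv : G₁.s (f₁ x) = f₁ x
  · have key := h₁.fiber_connected ⟨f₁ x, hv⟩ x y rfl h.symm
    have : ∀ v, G₁.s v = v → ∀ a b,
        Relation.EqvGen (fun a b => f₁ a = v ∧ (b = G.r a ∨ b = G.s a)) a b → f₂ a = f₂ b := by
      intro v hv a b hab
      induction hab with
      | rel a b hab =>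
        have h3 := hvert a (by rw [hab.1, hv])
        rcases hab.2 with rfl | rfl
        · rw [h₂.map_r, (G₂.r_eq_iff _).2 h3]
        · rw [h₂.map_s, h3]
      | refl => rfl
      | symm _ _ _ ih => exact ih.symm
      | trans _ _ _ _ _ ih1 ih2 => exact ih1.trans ih2
    exact this _ hv _ _ key
  · rw [(h₁.existsUnique_half ⟨f₁ x, hv⟩).unique rfl h.symm]

/-- Two morphisms that contract the same edges have isomorphic targets. -/
theorem IsMor.exists_isIsom {G G₁ G₂ : StableGraph g n} {f₁ : G.X → G₁.X} {f₂ : G.X → G₂.X}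
    (h₁ : IsMor f₁) (h₂ : IsMor f₂) (hr : Set.range h₁.pullE = Set.range h₂.pullE) :
    ∃ φ : G₁.X → G₂.X, IsIsom φ ∧ φ ∘ f₁ = f₂ := by
  classical
  have h12 : ∀ x, f₂ (Function.surjInv h₁.surjective (f₁ x)) = f₂ x := fun x =>
    h₁.eq_of_eq h₂ hr _ _ (Function.surjInv_eq h₁.surjective _)
  have hk : ∀ x y, f₂ x = f₂ y ↔ f₁ x = f₁ y := fun x y =>
    ⟨h₂.eq_of_eq h₁ hr.symm x y, h₁.eq_of_eq h₂ hr x y⟩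
  refine ⟨fun y => f₂ (Function.surjInv h₁.surjective y), ?_, funext h12⟩
  constructor
  · constructor
    · intro a b hab
      obtain ⟨a, rfl⟩ := h₁.surjective a
      obtain ⟨b, rfl⟩ := h₁.surjective b
      simp only [h12] at hab
      exact (hk _ _).1 hab
    · intro y
      obtain ⟨x, rfl⟩ := h₂.surjective y
      exact ⟨f₁ x, h12 x⟩
  · intro y
    obtain ⟨x, rfl⟩ := h₁.surjective y
    rw [← h₁.map_r, h12, h12, h₂.map_r]
  · intro y
    obtain ⟨x, rfl⟩ := h₁.surjective y
    rw [← h₁.map_s, h12, h12, h₂.map_s]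
  · intro i
    rw [← h₁.map_m, h12, h₂.map_m]
  · rintro v v' h
    obtain ⟨x, hx⟩ := h₁.surjective v.1
    rw [← hx, h12] at h
    have e1 := h₁.chi_fiber v.1
    have e2 := h₂.chi_fiber v'.1
    rw [show (Finset.univ.filter fun y => f₂ y = v'.1) = Finset.univ.filter fun y => f₁ y = v.1 by
      ext y; simp only [Finset.mem_filter, Finset.mem_univ, true_and, ← hx, ← h, hk], ← e1] at e2
    simp only [chi, v.2, v'.2, dite_true, Subtype.coe_eta] at e2
    have : (G₂.w v' : ℤ) = G₁.w v := by linarith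
    exact_mod_cast this

theorem IsMor.pullE_congr {G G' : StableGraph g n} {f f' : G.X → G'.X} (hf : IsMor f)
    (hf' : IsMor f') (h : f = f') : hf.pullE = hf'.pullE := by
  subst h; rfl

theorem isIsom_id (G : StableGraph g n) : IsIsom (G := G) (G' := G) id where
  bijective := Function.bijective_id
  map_r _ := rfl
  map_s _ := rfl
  map_m _ := rfl
  weight v v' h := by rw [Subtype.ext (h : v.1 = v'.1)]

theorem pullE_id (G : StableGraph g n) (e : G.E) : (isIsom_id G).isMor.pullE e = e := by
  induction e using Quotient.inductionOn with | h k => ?_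
  change G.edge _ = G.edge _
  congr 1
  exact IsMor.pullH_unique _ _ _ rfl

theorem IsIsom.range_pullE {G G' : StableGraph g n} {f : G.X → G'.X} (hf : IsIsom f) :
    Set.range hf.isMor.pullE = Set.univ := by
  refine Set.eq_univ_of_forall ?_
  rintro ⟨h⟩
  refine (hf.isMor.range_pullE h).2 fun e => h.2 (hf.bijective.1 ?_)
  rw [hf.map_s, e]

/-- A stable graph whose edges are labelled bijectively by `Fin k = {0, …, k - 1}`. -/
structure EdgeLabelled (g n k : ℕ) where
  graph : StableGraph g n
  τ : graph.E ≃ Fin k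

/-- `Q` is the face of `P` along `ι`: there is a morphism `f : P → Q` of stable graphs, contracting
the edges with label outside the image of `ι`, such that `τ_P ∘ f^* = ι ∘ τ_Q`. -/
def IsFace {k l : ℕ} (ι : Fin k ↪ Fin l) (P : EdgeLabelled g n l) (Q : EdgeLabelled g n k) : Prop :=
  ∃ (f : P.graph.X → Q.graph.X) (hf : IsMor f), ∀ e, P.τ (hf.pullE e) = ι (Q.τ e)

theorem IsFace.comp {j k l : ℕ} {ι : Fin k ↪ Fin l} {κ : Fin j ↪ Fin k} {P : EdgeLabelled g n l}
    {Q : EdgeLabelled g n k} {R : EdgeLabelled g n j} (h : IsFace ι P Q) (h' : IsFace κ Q R) :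
    IsFace (κ.trans ι) P R := by
  obtain ⟨f, hf, h⟩ := h
  obtain ⟨f', hf', h'⟩ := h'
  refine ⟨f' ∘ f, hf'.comp hf, fun e => ?_⟩
  rw [IsMor.pullE_comp hf' hf, h, h']
  rfl

theorem range_pullE_of_isFace {k l : ℕ} {ι : Fin k ↪ Fin l} {P : EdgeLabelled g n l}
    {Q : EdgeLabelled g n k} {f : P.graph.X → Q.graph.X} (hf : IsMor f)
    (h : ∀ e, P.τ (hf.pullE e) = ι (Q.τ e)) : Set.range hf.pullE = {e | P.τ e ∈ Set.range ι} := by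
  ext e
  constructor
  · rintro ⟨e', rfl⟩
    exact ⟨Q.τ e', (h e').symm⟩
  · rintro ⟨i, hi⟩
    refine ⟨Q.τ.symm i, P.τ.injective ?_⟩
    rw [h, Equiv.apply_symm_apply, hi]

/-- Isomorphism of edge-labelled stable graphs. -/
instance edgeLabelledSetoid (g n k : ℕ) : Setoid (EdgeLabelled g n k) where
  r P Q := ∃ (φ : P.graph.X → Q.graph.X) (hφ : IsIsom φ), ∀ e, P.τ (hφ.isMor.pullE e) = Q.τ e
  iseqv :=
    { refl := fun P => ⟨id, isIsom_id _, fun e => by rw [pullE_id]⟩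
      symm := by
        rintro P Q ⟨φ, hφ, h⟩
        obtain ⟨ψ, hψ, hc⟩ := hφ.isMor.exists_isIsom (isIsom_id P.graph).isMor
          (by rw [hφ.range_pullE, (isIsom_id P.graph).range_pullE])
        refine ⟨ψ, hψ, fun e => ?_⟩
        rw [← h, ← IsMor.pullE_comp hψ.isMor hφ.isMor,
          IsMor.pullE_congr _ (isIsom_id P.graph).isMor hc, pullE_id]
      trans := by
        rintro P Q R ⟨φ, hφ, h⟩ ⟨ψ, hψ, h'⟩
        have hc : IsIsom (ψ ∘ φ) := (hψ.isMor.comp hφ.isMor).isIsom (hψ.bijective.comp hφ.bijective)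
        refine ⟨ψ ∘ φ, hc, fun e => ?_⟩
        rw [← h', ← h, ← IsMor.pullE_comp hψ.isMor hφ.isMor] }

theorem isFace_of_equiv {k : ℕ} {P Q : EdgeLabelled g n k} (h : P ≈ Q) :
    IsFace (Function.Embedding.refl _) P Q := by
  obtain ⟨φ, hφ, h⟩ := h
  exact ⟨φ, hφ.isMor, h⟩

theorem IsFace.unique {k l : ℕ} {ι : Fin k ↪ Fin l} {P : EdgeLabelled g n l}
    {Q Q' : EdgeLabelled g n k} (h : IsFace ι P Q) (h' : IsFace ι P Q') : Q ≈ Q' := by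
  obtain ⟨f, hf, h⟩ := h
  obtain ⟨f', hf', h'⟩ := h'
  obtain ⟨φ, hφ, hc⟩ := hf.exists_isIsom hf'
    (by rw [range_pullE_of_isFace hf h, range_pullE_of_isFace hf' h'])
  refine ⟨φ, hφ, fun e => ι.injective ?_⟩
  rw [← h, ← h', ← IsMor.pullE_comp hφ.isMor hf, IsMor.pullE_congr _ hf' hc]

/-- The edges that are contracted when passing to the face along `ι`. -/
def faceEdges {k l : ℕ} (ι : Fin k ↪ Fin l) (P : EdgeLabelled g n l) : Set P.graph.E :=
  {e | P.τ e ∉ Set.range ι}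

theorem faceEdges_label {k l : ℕ} (ι : Fin k ↪ Fin l) (P : EdgeLabelled g n l)
    (e : (contract P.graph (faceEdges ι P)).E) :
    ∃ i, ι i = P.τ ((contract_isMor P.graph (faceEdges ι P)).pullE e) := by
  have h : (contract_isMor P.graph (faceEdges ι P)).pullE e ∈ (faceEdges ι P)ᶜ := by
    rw [← range_pullE_contract]; exact ⟨e, rfl⟩
  simpa [faceEdges] using h

/-- The face of an edge-labelled graph along `ι : Fin k ↪ Fin l`: contract the edges whose label is not
in the image of `ι`, and label the other edges by the preimages of their labels. -/
noncomputable def face {k l : ℕ} (ι : Fin k ↪ Fin l) (P : EdgeLabelled g n l) :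
    EdgeLabelled g n k where
  graph := contract P.graph (faceEdges ι P)
  τ := Equiv.ofBijective (fun e => (faceEdges_label ι P e).choose) (by
    have h := fun e => (faceEdges_label ι P e).choose_spec
    constructor
    · intro a b hab
      apply (contract_isMor P.graph (faceEdges ι P)).pullE.injective
      apply P.τ.injective
      rw [← h a, ← h b]
      exact congrArg ι hab
    · intro i
      have h1 : P.τ.symm (ι i) ∈ Set.range (contract_isMor P.graph (faceEdges ι P)).pullE := by
        rw [range_pullE_contract]
        simp [faceEdges]
      obtain ⟨e, he⟩ := h1
      exact ⟨e, ι.injective (by rw [h e, he, Equiv.apply_symm_apply])⟩)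

theorem isFace_face {k l : ℕ} (ι : Fin k ↪ Fin l) (P : EdgeLabelled g n l) :
    IsFace ι P (face ι P) :=
  ⟨_, contract_isMor P.graph (faceEdges ι P), fun e => (faceEdges_label ι P e).choose_spec.symm⟩

/-- The category with objects the finite sets `[p] = {0, …, p}`, `p ≥ -1`, and injections as
morphisms. The object `[p]` is encoded by its cardinality `p + 1`. -/
structure InjIndex where
  card : ℕ

instance : Category InjIndex where
  Hom a b := Fin a.card ↪ Fin b.card
  id _ := Function.Embedding.refl _
  comp f h := f.trans h

/-- Symmetric `Δ`-complexes (symmetric semi-simplicial sets, with augmentation); morphisms are natural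
transformations. -/
abbrev SymmDeltaComplex := InjIndexᵒᵖ ⥤ Type 1

/-- The symmetric `Δ`-complex `Δ_{g,n}`: its `p`-simplices are the isomorphism classes of stable graphs
with edges labelled by `[p]`. -/
noncomputable def Delta (g n : ℕ) : SymmDeltaComplex where
  obj k := Quotient (edgeLabelledSetoid g n k.unop.card)
  map {k l} ι := ↾(Quotient.map (face (k := l.unop.card) (l := k.unop.card) ι.unop) fun P Q h =>
    (isFace_face _ P).unique ((isFace_of_equiv h).comp (isFace_face _ Q)))
  map_id k := by
    ext ⟨P⟩
    exact Quotient.sound ((isFace_face _ P).unique (isFace_of_equiv (Setoid.refl P)))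
  map_comp {k l j} ι κ := by
    ext ⟨P⟩
    exact Quotient.sound ((isFace_face _ P).unique
      ((isFace_face ι.unop P).comp (isFace_face κ.unop _)))

/-- The simplex of `Δ_{g,n}` given by an edge-labelled graph. -/
noncomputable def Delta.simplex {g n k : ℕ} (P : EdgeLabelled g n k) : (Delta g n).obj (op ⟨k⟩) :=
  Quotient.mk (edgeLabelledSetoid g n k) P

/-- A (small) diagram of smooth rational polyhedral cones and face morphisms. The cone with index `j` is
the orthant `ℝ≥0 ^ coord j` with its standard integral structure `ℤ ^ coord j`. A face morphism
from the orthant of `i` to the orthant of `j` is the extension by zero along an injection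
`coord i ↪ coord j`; `face i j` is the set of those that occur in the diagram. -/
structure ConeDiagram where
  J : Type 1
  coord : J → Type
  fintype : ∀ j, Fintype (coord j)
  face : ∀ i j, Set (coord i ↪ coord j)

namespace ConeDiagram

instance (D : ConeDiagram) (j : D.J) : Fintype (D.coord j) := D.fintype j

/-- The gluing along face morphisms, for cones with coordinates in `R`; here `R` is `ℝ≥0`, or `ℝ≥0∞` in the
case of extended cones. -/
inductive Glue (R : Type) [Zero R] (D : ConeDiagram) :
    (Σ j, D.coord j → R) → (Σ j, D.coord j → R) → Prop
  | of {i j : D.J} (ι : D.coord i ↪ D.coord j) (hι : ι ∈ D.face i j) (x : D.coord i → R) :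
      Glue R D ⟨i, x⟩ ⟨j, Function.extend ι x 0⟩

/-- The colimit, in topological spaces, of the diagram of cones (`R = ℝ≥0`) or of extended cones
(`R = ℝ≥0∞`). -/
def Space (R : Type) [Zero R] (D : ConeDiagram) : Type 1 := Quot (Glue R D)

instance (R : Type) [Zero R] [TopologicalSpace R] (D : ConeDiagram) : TopologicalSpace (D.Space R) :=
  inferInstanceAs (TopologicalSpace (Quot (Glue R D)))

/-- The canonical map from a cone of the diagram to the colimit. -/
def toSpace {R : Type} [Zero R] (D : ConeDiagram) (j : D.J) (x : D.coord j → R) : D.Space R :=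
  Quot.mk _ ⟨j, x⟩

theorem coe_extend {A B : Type} (ι : A ↪ B) (x : A → ℝ≥0) :
    (fun e => ((Function.extend ι x 0 e : ℝ≥0) : ℝ≥0∞))
      = Function.extend ι (fun e => (x e : ℝ≥0∞)) 0 := by
  funext e
  by_cases he : ∃ a, ι a = e
  · obtain ⟨a, rfl⟩ := he
    rw [ι.injective.extend_apply, ι.injective.extend_apply]
  · rw [Function.extend_apply' _ _ _ he, Function.extend_apply' _ _ _ he]
    rfl

/-- The map from the colimit of the cones to the colimit of the extended cones, induced by the inclusions
`ℝ≥0 ^ A → [0, ∞] ^ A`. -/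
def inclExt (D : ConeDiagram) : D.Space ℝ≥0 → D.Space ℝ≥0∞ :=
  Quot.map (fun p => ⟨p.1, fun e => (p.2 e : ℝ≥0∞)⟩) (by
    rintro _ _ ⟨ι, hι, x⟩
    dsimp only
    rw [coe_extend]
    exact .of ι hι _)

end ConeDiagram

/-- Morphisms of smooth cones `ℝ≥0 ^ A → ℝ≥0 ^ B`: every coordinate of the target pulls back to an integral
linear function, which is nonnegative on the source, that is, to an `ℕ`-combination of coordinates. -/
def IsConeMor {A B : Type} [Fintype A] (L : (A → ℝ≥0) → (B → ℝ≥0)) : Prop :=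
  ∀ b, ∃ a : A → ℕ, ∀ x, L x b = ∑ i, a i * x i

/-- Morphisms of smooth extended cones `[0, ∞] ^ A → [0, ∞] ^ B`: every coordinate of the target pulls back to
an `ℕ`-combination of coordinates (with `0 * ∞ = 0`) or to the constant `∞`. These are the morphisms of
cones, extended by continuity, to the target or to one of its faces at infinity. -/
def IsExtConeMor {A B : Type} [Fintype A] (L : (A → ℝ≥0∞) → (B → ℝ≥0∞)) : Prop :=
  ∀ b, (∃ a : A → ℕ, ∀ x, L x b = ∑ i, a i * x i) ∨ ∀ x, L x b = ⊤

theorem isConeMor_id {A : Type} [Fintype A] : IsConeMor (id : (A → ℝ≥0) → (A → ℝ≥0)) := by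
  classical
  exact fun b => ⟨Pi.single b 1, fun x => by simp [Pi.single_apply]⟩

theorem IsConeMor.comp {A B C : Type} [Fintype A] [Fintype B] {L' : (B → ℝ≥0) → (C → ℝ≥0)}
    {L : (A → ℝ≥0) → (B → ℝ≥0)} (h' : IsConeMor L') (h : IsConeMor L) : IsConeMor (L' ∘ L) := by
  intro c
  obtain ⟨a', ha'⟩ := h' c
  choose a ha using h
  refine ⟨fun i => ∑ b, a' b * a b i, fun x => ?_⟩
  simp only [Function.comp, ha', ha, Finset.mul_sum]
  rw [Finset.sum_comm]
  refine Finset.sum_congr rfl fun i _ => ?_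
  push_cast
  rw [Finset.sum_mul]
  exact Finset.sum_congr rfl fun b _ => (mul_assoc _ _ _).symm

theorem isExtConeMor_id {A : Type} [Fintype A] : IsExtConeMor (id : (A → ℝ≥0∞) → (A → ℝ≥0∞)) := by
  classical
  exact fun b => Or.inl ⟨Pi.single b 1, fun x => by simp [Pi.single_apply]⟩

theorem IsExtConeMor.comp {A B C : Type} [Fintype A] [Fintype B] {L' : (B → ℝ≥0∞) → (C → ℝ≥0∞)}
    {L : (A → ℝ≥0∞) → (B → ℝ≥0∞)} (h' : IsExtConeMor L') (h : IsExtConeMor L) :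
    IsExtConeMor (L' ∘ L) := by
  intro c
  rcases h' c with ⟨a', ha'⟩ | hc
  · by_cases hinf : ∃ b, a' b ≠ 0 ∧ ∀ x, L x b = ⊤
    · right
      obtain ⟨b, hb, hx⟩ := hinf
      intro x
      simp only [Function.comp, ha']
      refine WithTop.sum_eq_top.2 ⟨b, Finset.mem_univ _, ?_⟩
      rw [hx]
      exact ENNReal.mul_top (by exact_mod_cast hb)
    · left
      push Not at hinf
      have h1 : ∀ b, ∃ a : A → ℕ, a' b ≠ 0 → ∀ x, L x b = ∑ i, a i * x i := by
        intro b
        by_cases hb : a' b = 0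
        · exact ⟨0, fun h => (h hb).elim⟩
        · rcases h b with ⟨a, ha⟩ | ht
          · exact ⟨a, fun _ => ha⟩
          · obtain ⟨x, hx⟩ := hinf b hb
            exact (hx (ht x)).elim
      choose a ha using h1
      refine ⟨fun i => ∑ b, a' b * a b i, fun x => ?_⟩
      simp only [Function.comp, ha']
      have h2 : ∀ b, (a' b : ℝ≥0∞) * L x b = ∑ i, (a' b : ℝ≥0∞) * (a b i * x i) := by
        intro b
        by_cases hb : a' b = 0
        · simp [hb]
        · rw [ha b hb, Finset.mul_sum]
      simp only [h2]
      rw [Finset.sum_comm]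
      refine Finset.sum_congr rfl fun i _ => ?_
      push_cast
      rw [Finset.sum_mul]
      exact Finset.sum_congr rfl fun b _ => (mul_assoc _ _ _).symm
  · exact Or.inr fun x => hc _

/-- Smooth generalized cone complexes: topological spaces presented as the colimit of a diagram of
smooth cones and face morphisms. -/
structure GenConeComplex where
  diagram : ConeDiagram

/-- The underlying topological space. -/
abbrev GenConeComplex.Points (M : GenConeComplex) : Type 1 := M.diagram.Space ℝ≥0

/-- Morphisms of generalized cone complexes: continuous maps such that the composite with the canonical
map of every cone of the source factors through a morphism to some cone of the target. -/
@[ext]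
structure GenConeComplex.Hom (M N : GenConeComplex) where
  toFun : M.Points → N.Points
  continuous : Continuous toFun
  lift : ∀ i, ∃ (j : N.diagram.J) (L : (M.diagram.coord i → ℝ≥0) → (N.diagram.coord j → ℝ≥0)),
    IsConeMor L ∧ ∀ x, toFun (M.diagram.toSpace i x) = N.diagram.toSpace j (L x)

instance : Category GenConeComplex where
  Hom := GenConeComplex.Hom
  id M := ⟨id, continuous_id, fun i => ⟨i, id, isConeMor_id, fun _ => rfl⟩⟩
  comp f h := ⟨h.toFun ∘ f.toFun, h.continuous.comp f.continuous, fun i => by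
    obtain ⟨j, L, hL, e⟩ := f.lift i
    obtain ⟨k, L', hL', e'⟩ := h.lift j
    exact ⟨k, L' ∘ L, hL'.comp hL, fun x => by simp [e, e']⟩⟩

/-- Smooth extended generalized cone complexes: topological spaces presented as the colimit of a diagram
of smooth extended cones and (extended) face morphisms. -/
structure ExtGenConeComplex where
  diagram : ConeDiagram

/-- The underlying topological space. -/
abbrev ExtGenConeComplex.Points (M : ExtGenConeComplex) : Type 1 := M.diagram.Space ℝ≥0∞

/-- Morphisms of extended generalized cone complexes. -/
@[ext]
structure ExtGenConeComplex.Hom (M N : ExtGenConeComplex) where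
  toFun : M.Points → N.Points
  continuous : Continuous toFun
  lift : ∀ i, ∃ (j : N.diagram.J) (L : (M.diagram.coord i → ℝ≥0∞) → (N.diagram.coord j → ℝ≥0∞)),
    IsExtConeMor L ∧ ∀ x, toFun (M.diagram.toSpace i x) = N.diagram.toSpace j (L x)

instance : Category ExtGenConeComplex where
  Hom := ExtGenConeComplex.Hom
  id M := ⟨id, continuous_id, fun i => ⟨i, id, isExtConeMor_id, fun _ => rfl⟩⟩
  comp f h := ⟨h.toFun ∘ f.toFun, h.continuous.comp f.continuous, fun i => by
    obtain ⟨j, L, hL, e⟩ := f.lift i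
    obtain ⟨k, L', hL', e'⟩ := h.lift j
    exact ⟨k, L' ∘ L, hL'.comp hL, fun x => by simp [e, e']⟩⟩

/-- The diagram of the cones `ℝ≥0 ^ E(G)`, for `G` in the category of stable graphs of type `(g, n)`, with one face
morphism `ℝ≥0 ^ E(G') → ℝ≥0 ^ E(G)`, extension by zero along `f^*`, for every morphism `f : G → G'`. -/
noncomputable def tropDiagram (g n : ℕ) : ConeDiagram where
  J := StableGraph g n
  coord G := G.E
  fintype _ := inferInstance
  face G' G := {ι | ∃ (f : G.X → G'.X) (hf : IsMor f), hf.pullE = ι}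

/-- The moduli space `M^trop_{g,n}` of tropical curves. -/
noncomputable def Mtrop (g n : ℕ) : GenConeComplex := ⟨tropDiagram g n⟩

/-- The moduli space of extended tropical curves, whose edge lengths may be infinite. -/
noncomputable def MtropBar (g n : ℕ) : ExtGenConeComplex := ⟨tropDiagram g n⟩

/-- The point of `M^trop_{g,n}` given by a stable graph with edge lengths (edges of length zero are
contracted). -/
noncomputable def Mtrop.point {g n : ℕ} (G : StableGraph g n) (l : G.E → ℝ≥0) : (Mtrop g n).Points :=
  (tropDiagram g n).toSpace G l

/-- The inclusion of `M^trop_{g,n}` into its compactification. -/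
noncomputable def Mtrop.incl (g n : ℕ) : (Mtrop g n).Points → (MtropBar g n).Points :=
  (tropDiagram g n).inclExt

/-- The cell of `M^trop_{g,n}` given by a simplex of `Δ_{g,n}`, i.e. the cone over that simplex: the simplex
`[G, τ]` and `a : [p] → ℝ≥0` give the tropical curve `(G, a ∘ τ)`. Its points of volume `∑ a = 1` make up
the image of the simplex under the inclusion of the geometric realization of `Δ_{g,n}` in `M^trop_{g,n}`. -/
noncomputable def Delta.cell {g n k : ℕ} (σ : (Delta g n).obj (op ⟨k⟩)) (a : Fin k → ℝ≥0) : (Mtrop g n).Points :=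
  Quotient.lift (s := edgeLabelledSetoid g n k) (fun P => Mtrop.point P.graph (a ∘ P.τ)) (by
    rintro P Q ⟨φ, hφ, h⟩
    refine (Quot.sound ?_ : Mtrop.point Q.graph (a ∘ Q.τ) = Mtrop.point P.graph (a ∘ P.τ)).symm
    have h1 : a ∘ P.τ = Function.extend hφ.isMor.pullE (a ∘ Q.τ) 0 := by
      funext e
      have he : e ∈ Set.range hφ.isMor.pullE := hφ.range_pullE ▸ Set.mem_univ e
      obtain ⟨e', rfl⟩ := he
      rw [hφ.isMor.pullE.injective.extend_apply, Function.comp, h, Function.comp]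
    rw [h1]
    exact .of (D := tropDiagram g n) (i := Q.graph) (j := P.graph) hφ.isMor.pullE ⟨φ, hφ.isMor, rfl⟩ _) σ

end TropModuli

namespace TropModuli

variable {g n : ℕ}

/-! An automorphism of $\Delta_{g,n}$ acts on either space by replacing the simplex of a cell and
keeping the lengths; naturality makes this compatible with the face gluings. The content is that
every automorphism of either space arises in this way from exactly one automorphism of
$\Delta_{g,n}$. Both isomorphisms of the theorem are then read off from these two actions of
$\operatorname{Aut}(\Delta_{g,n})$.

Both spaces are treated at once, with lengths in a semiring `R` that is `ℝ≥0` or `ℝ≥0∞`. On the cone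
of $G$ an automorphism $F$ is given by a matrix over $\mathbb{N}$. No column is zero, since
otherwise a whole ray would go to one point; hence $F$ does not decrease the volume (the sum of the
lengths). The same holds for $F^{-1}$, so volume is preserved, every column sums to 1, and every
column is a unit vector. Two equal columns $i \ne j$ would give $e_i + e_j$ and $2e_i$ the same
image, although these points have different numbers of nonzero lengths. So $F$ is extension by zero
along an injection of edge sets (`exists_embedding_of_natLifts`), and it carries each cell to a cell
with the same lengths.

The target simplex is unique because a point with nonzero, pairwise distinct lengths determines the
edge-labelled graph up to isomorphism (`tropCell_injective`, from the normal form
`exists_isMor_of_tropPoint_eq`). Uniqueness also yields naturality and compatibility with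
composition.

In the extended case coordinates constantly $\infty$ must be excluded first. This holds because a
surjective morphism fixes the cone point, where all lengths vanish (`MtropBar.hasNatLifts`). -/

/-! ### Extension by zero along injections -/

theorem extend_conj {A B A' B' R : Type} [Zero R] {ι : A ↪ B} {κ : A' ↪ B'} {τ : A ≃ A'} {τ' : B ≃ B'}
    (h : ∀ e, τ' (ι e) = κ (τ e)) (a : A' → R) :
    Function.extend ι (a ∘ τ) 0 = Function.extend κ a 0 ∘ τ' := by
  funext b
  by_cases hb : ∃ e, ι e = b
  · obtain ⟨e, rfl⟩ := hb
    rw [ι.injective.extend_apply, Function.comp, Function.comp, h, κ.injective.extend_apply]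
  · rw [Function.extend_apply' _ _ _ hb, Function.comp, Function.extend_apply']
    · rfl
    · rintro ⟨e, he⟩
      refine hb ⟨τ.symm e, τ'.injective ?_⟩
      rw [h, Equiv.apply_symm_apply, he]

/-- Supplies the hypothesis of `extend_conj` for arbitrary labellings: an injection of edges becomes
an injection of labels after conjugation. -/
theorem conj_apply {A B A' B' : Type} (ι : A ↪ B) (τ : A ≃ A') (τ' : B ≃ B') (e : A) :
    τ' (ι e) = ((τ.symm.toEmbedding.trans ι).trans τ'.toEmbedding) (τ e) := by
  simp

theorem extend_trans {A B C R : Type} [Zero R] (ι : A ↪ B) (κ : B ↪ C) (x : A → R) :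
    Function.extend κ (Function.extend ι x 0) 0 = Function.extend (ι.trans κ) x 0 := by
  funext c
  by_cases hc : ∃ b, κ b = c
  · obtain ⟨b, rfl⟩ := hc
    rw [κ.injective.extend_apply]
    by_cases hb : ∃ a, ι a = b
    · obtain ⟨a, rfl⟩ := hb
      rw [ι.injective.extend_apply]
      exact ((ι.trans κ).injective.extend_apply x 0 a).symm
    · rw [Function.extend_apply' _ _ _ hb, Function.extend_apply']
      · rfl
      · rintro ⟨a, ha⟩
        exact hb ⟨a, κ.injective ha⟩
  · rw [Function.extend_apply' _ _ _ hc, Function.extend_apply']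
    rintro ⟨a, ha⟩
    exact hc ⟨ι a, ha⟩

theorem extend_ne_zero_iff {A B R : Type} [Zero R] (ι : A ↪ B) (x : A → R) (b : B) :
    Function.extend ι x 0 b ≠ 0 ↔ ∃ a, ι a = b ∧ x a ≠ 0 := by
  by_cases hb : ∃ a, ι a = b
  · obtain ⟨a, rfl⟩ := hb
    rw [ι.injective.extend_apply]
    exact ⟨fun h => ⟨a, rfl, h⟩, fun ⟨a', h, h'⟩ => ι.injective h ▸ h'⟩
  · rw [Function.extend_apply' _ _ _ hb]
    exact ⟨fun h => (h rfl).elim, fun ⟨a, h, _⟩ => (hb ⟨a, h⟩).elim⟩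

/-! ### Factoring morphisms of stable graphs, and graphs without edges -/

/-- Such an `f` contracts the same edges as the identity, namely none, so the two targets are
identified by an isomorphism that must be `f`. -/
theorem IsMor.isIsom_of_range {G G' : StableGraph g n} {f : G.X → G'.X} (hf : IsMor f)
    (h : Set.range hf.pullE = Set.univ) : IsIsom f := by
  obtain ⟨φ, hφ, hc⟩ := (isIsom_id G).isMor.exists_isIsom hf (by rw [h, (isIsom_id G).range_pullE])
  exact hc ▸ hφ

/-- A morphism factors through every morphism that contracts fewer edges. -/
theorem IsMor.exists_factor {G G₁ G₂ : StableGraph g n} {f : G.X → G₁.X} {h : G.X → G₂.X}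
    (hf : IsMor f) (hh : IsMor h) (hr : Set.range hh.pullE ⊆ Set.range hf.pullE) :
    ∃ k : G₁.X → G₂.X, IsMor k ∧ k ∘ f = h := by
  -- Contract in `G₁` exactly the remaining edges that `h` contracts; then `c ∘ f` and `h` contract
  -- the same edges of `G`.
  let c := contract_isMor G₁ {e | hf.pullE e ∉ Set.range hh.pullE}
  have hc : Set.range (c.comp hf).pullE = Set.range hh.pullE := by
    have hc' : Set.range c.pullE = {e | hf.pullE e ∉ Set.range hh.pullE}ᶜ :=
      range_pullE_contract _ _
    ext e
    constructor
    · rintro ⟨e', rfl⟩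
      have h1 : c.pullE e' ∈ {e | hf.pullE e ∉ Set.range hh.pullE}ᶜ := hc' ▸ ⟨e', rfl⟩
      exact (IsMor.pullE_comp c hf e').symm ▸ not_not.1 h1
    · intro he
      obtain ⟨e₁, rfl⟩ := hr he
      have h1 : e₁ ∈ Set.range c.pullE := by
        rw [hc']
        exact fun h2 => h2 he
      obtain ⟨e', rfl⟩ := h1
      exact ⟨e', IsMor.pullE_comp _ _ _⟩
  obtain ⟨φ, hφ, e⟩ := (c.comp hf).exists_isIsom hh hc
  exact ⟨_, hφ.isMor.comp c, e⟩

/-- Without edges, connectedness leaves a single vertex; it carries all markings, and the genus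
formula forces its weight to be `g`. -/
theorem exists_isIsom_of_isEmpty {G G' : StableGraph g n} (hG : IsEmpty G.E) (hG' : IsEmpty G'.E) :
    ∃ f : G.X → G'.X, IsIsom f := by
  classical
  have vert : ∀ {G : StableGraph g n}, IsEmpty G.E → ∀ x, G.s x = x := fun {G} h x => by
    by_contra hx
    exact h.false (G.edge ⟨x, hx⟩)
  have sub : ∀ {G : StableGraph g n}, IsEmpty G.E → ∀ x y : G.X, x = y := fun {G} h x y => by
    induction G.connected.2 x y with
    | rel a b hab =>
      rcases hab with rfl | rfl
      · exact ((G.r_eq_iff a).2 (vert h a)).symm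
      · exact (vert h a).symm
    | refl => rfl
    | symm _ _ _ ih => exact ih.symm
    | trans _ _ _ _ _ ih1 ih2 => exact ih1.trans ih2
  have wt : ∀ {G : StableGraph g n}, IsEmpty G.E → ∀ v : G.V, (G.w v : ℤ) = g := fun {G} h v => by
    have h1 := sum_chi_eq_genus _ G.w
    have : (Finset.univ : Finset G.X) = {v.1} := by
      ext x
      simp [sub h x v.1]
    rw [this, Finset.sum_singleton, chi, dif_pos v.2, G.genus_eq] at h1
    linarith
  obtain ⟨⟨x'⟩, -⟩ := G'.connected
  refine ⟨fun _ => x', ⟨⟨fun a b _ => sub hG a b, fun b => ⟨G.connected.1.some, sub hG' _ _⟩⟩,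
    fun _ => sub hG' _ _, fun _ => sub hG' _ _, fun _ => sub hG' _ _, fun v v' _ => ?_⟩⟩
  exact_mod_cast (wt hG' v').trans (wt hG v).symm

/-! ### Points of the colimit: cone point, rank, normal form -/

section Space

variable {R : Type}

section Zero

variable [Zero R]

/-- The point of the colimit of cones given by a stable graph with edge lengths in `R`. -/
noncomputable def tropPoint (G : StableGraph g n) (x : G.E → R) : (tropDiagram g n).Space R :=
  (tropDiagram g n).toSpace G x

theorem tropPoint_extend {G G' : StableGraph g n} {f : G.X → G'.X} (hf : IsMor f) (x : G'.E → R) :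
    tropPoint G (Function.extend hf.pullE x 0) = tropPoint G' x :=
  (Quot.sound (.of (D := tropDiagram g n) (i := G') (j := G) hf.pullE ⟨f, hf, rfl⟩ x)).symm

/-- Functions on the colimit of cones are families of functions on the cones that are compatible with
the face morphisms. -/
noncomputable def tropLift {Y : Sort*} (F : ∀ G : StableGraph g n, (G.E → R) → Y)
    (hF : ∀ (G G' : StableGraph g n) (f : G.X → G'.X) (hf : IsMor f) (x : G'.E → R),
      F G (Function.extend hf.pullE x 0) = F G' x) : (tropDiagram g n).Space R → Y :=
  Quot.lift (fun p => F p.1 p.2) (by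
    rintro _ _ ⟨_, ⟨f, hf, rfl⟩, x⟩
    exact (hF _ _ f hf x).symm)

/-- All cones share one apex: contracting every edge reduces to graphs without edges, which are all
isomorphic. -/
theorem tropPoint_zero (G G' : StableGraph g n) :
    tropPoint G (0 : G.E → R) = tropPoint G' (0 : G'.E → R) := by
  have h0 : ∀ {G G' : StableGraph g n} {f : G.X → G'.X}, IsMor f →
      tropPoint G (0 : G.E → R) = tropPoint G' (0 : G'.E → R) := fun {G G' f} hf => by
    rw [← tropPoint_extend hf]
    congr 1
    funext e
    by_contra h
    obtain ⟨_, -, h⟩ := (extend_ne_zero_iff _ _ _).1 (Ne.symm h)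
    exact h rfl
  have he : ∀ G : StableGraph g n, IsEmpty (contract G Set.univ).E := fun G => by
    refine ⟨fun e => ?_⟩
    have : (contract_isMor G Set.univ).pullE e ∈ (Set.univ : Set G.E)ᶜ := by
      rw [← range_pullE_contract]
      exact ⟨e, rfl⟩
    exact this trivial
  obtain ⟨f, hf⟩ := exists_isIsom_of_isEmpty (he G) (he G')
  rw [h0 (contract_isMor G Set.univ), h0 hf.isMor, ← h0 (contract_isMor G' Set.univ)]

/-- The number of edges of nonzero length. -/
noncomputable def tropRank : (tropDiagram g n).Space R → ℕ :=
  tropLift (fun G x => Nat.card {e : G.E // x e ≠ 0}) (by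
    intro G G' f hf x
    refine (Nat.card_congr (Equiv.ofBijective (fun e => ⟨hf.pullE e.1,
      (extend_ne_zero_iff _ _ _).2 ⟨_, rfl, e.2⟩⟩) ⟨?_, ?_⟩)).symm
    · intro a b h
      exact Subtype.ext (hf.pullE.injective (congrArg Subtype.val h))
    · rintro ⟨e, he⟩
      obtain ⟨a, rfl, ha⟩ := (extend_ne_zero_iff _ _ _).1 he
      exact ⟨⟨a, ha⟩, rfl⟩)

theorem tropRank_point (G : StableGraph g n) (x : G.E → R) :
    tropRank (tropPoint G x) = Nat.card {e // x e ≠ 0} := rfl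

theorem tropRank_eq_zero {G : StableGraph g n} {x : G.E → R} :
    tropRank (tropPoint G x) = 0 ↔ x = 0 := by
  rw [tropRank_point, Finite.card_eq_zero_iff, isEmpty_subtype, funext_iff]
  simp

/-- If the edge lengths `x'` are nonzero, then `(G, x)` and `(G', x')` give the same point only if `G'` is
obtained from `G` by contracting the edges of length zero. -/
theorem exists_isMor_of_tropPoint_eq {G G' : StableGraph g n} {x : G.E → R} {x' : G'.E → R}
    (hx' : ∀ e, x' e ≠ 0) (h : tropPoint G x = tropPoint G' x') :
    ∃ (f : G.X → G'.X) (hf : IsMor f), x = Function.extend hf.pullE x' 0 := by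
  -- `T` is invariant under the generating gluings, so it descends to the colimit; it holds at `(G',
  -- x')` through the identity.
  let T : ∀ H : StableGraph g n, (H.E → R) → Prop := fun H y =>
    ∃ (f : H.X → G'.X) (hf : IsMor f), y = Function.extend hf.pullE x' 0
  have key : ∀ (H H' : StableGraph g n) (f : H.X → H'.X) (hf : IsMor f) (y : H'.E → R),
      T H (Function.extend hf.pullE y 0) = T H' y := by
    intro H H' f hf y
    refine propext ⟨?_, ?_⟩
    · rintro ⟨k, hk, e⟩
      -- Since `x'` vanishes nowhere, every edge that `k` keeps has nonzero length, so `f` keeps it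
      -- too; hence `k` factors through `f`.
      have hsub : Set.range hk.pullE ⊆ Set.range hf.pullE := by
        rintro _ ⟨a, rfl⟩
        have h1 : Function.extend hf.pullE y 0 (hk.pullE a) ≠ 0 := by
          rw [e, hk.pullE.injective.extend_apply]
          exact hx' a
        obtain ⟨b, hb, -⟩ := (extend_ne_zero_iff _ _ _).1 h1
        exact ⟨b, hb⟩
      obtain ⟨l, hl, rfl⟩ := hf.exists_factor hk hsub
      refine ⟨l, hl, ?_⟩
      have h2 : Function.extend hk.pullE x' 0
          = Function.extend hf.pullE (Function.extend hl.pullE x' 0) 0 := by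
        rw [extend_trans]
        congr 1
        exact funext fun e => IsMor.pullE_comp hl hf e
      funext b
      have h3 := congrFun (e.trans h2) (hf.pullE b)
      rwa [hf.pullE.injective.extend_apply, hf.pullE.injective.extend_apply] at h3
    · rintro ⟨k, hk, e⟩
      refine ⟨_, hk.comp hf, ?_⟩
      rw [e, extend_trans]
      congr 1
      exact funext fun e => (IsMor.pullE_comp hk hf e).symm
  have h1 : T G x = T G' x' := congrArg (tropLift T key) h
  change T G x
  rw [h1]
  refine ⟨id, (isIsom_id G').isMor, ?_⟩
  funext e
  conv_rhs => rw [← pullE_id G' e]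
  exact ((isIsom_id G').isMor.pullE.injective.extend_apply x' 0 e).symm

/-! ### Cells of simplices and their faces -/

/-- The points of the cell of a simplex of `Δ_{g,n}`, with lengths in `R`. -/
noncomputable def tropCell {k : ℕ} (σ : (Delta g n).obj (op ⟨k⟩)) (a : Fin k → R) :
    (tropDiagram g n).Space R :=
  Quotient.lift (s := edgeLabelledSetoid g n k) (fun P => tropPoint P.graph (a ∘ P.τ)) (by
    rintro P Q ⟨φ, hφ, h⟩
    have h1 : Function.extend hφ.isMor.pullE (a ∘ Q.τ) 0 = a ∘ P.τ := by
      rw [extend_conj (κ := Function.Embedding.refl _) (τ' := P.τ) h]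
      congr 1
      exact funext fun i => (Function.Embedding.refl _).injective.extend_apply a 0 i
    change tropPoint P.graph (a ∘ P.τ) = _
    rw [← h1, tropPoint_extend]) σ

/-- Nonzero lengths leave no edge to contract, so equal points come from isomorphic graphs; distinct
lengths then force the isomorphism to respect the labels. -/
theorem tropCell_injective {k : ℕ} {a : Fin k → R} (ha : Function.Injective a) (h0 : ∀ i, a i ≠ 0)
    {σ σ' : (Delta g n).obj (op ⟨k⟩)} (h : tropCell σ a = tropCell σ' a) : σ = σ' := by
  obtain ⟨P⟩ := σ
  obtain ⟨Q⟩ := σ'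
  obtain ⟨f, hf, e⟩ := exists_isMor_of_tropPoint_eq (fun e => h0 _) h
  have h1 : Set.range hf.pullE = Set.univ := by
    refine Set.eq_univ_of_forall fun b => ?_
    have h2 : Function.extend hf.pullE (a ∘ Q.τ) 0 b ≠ 0 := e ▸ h0 _
    obtain ⟨c, hc, -⟩ := (extend_ne_zero_iff _ _ _).1 h2
    exact ⟨c, hc⟩
  refine Quotient.sound ⟨f, hf.isIsom_of_range h1, fun b => ha ?_⟩
  have h2 := congrFun e (hf.pullE b)
  rwa [hf.pullE.injective.extend_apply] at h2

/-- An injection, as a morphism of the index category of symmetric `Δ`-complexes. -/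
abbrev faceHom {k l : ℕ} (ι : Fin k ↪ Fin l) :
    (op (⟨l⟩ : InjIndex)) ⟶ (op (⟨k⟩ : InjIndex)) :=
  Quiver.Hom.op (show (⟨k⟩ : InjIndex) ⟶ ⟨l⟩ from ι)

theorem simplex_of_isFace {k l : ℕ} {ι : Fin k ↪ Fin l} {P : EdgeLabelled g n l}
    {Q : EdgeLabelled g n k} (h : IsFace ι P Q) :
    (Delta g n).map (faceHom ι) (Delta.simplex P) = Delta.simplex Q :=
  Quotient.sound ((isFace_face ι P).unique h)

theorem tropCell_map {k l : ℕ} (ι : Fin k ↪ Fin l) (σ : (Delta g n).obj (op ⟨l⟩)) (a : Fin k → R) :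
    tropCell ((Delta g n).map (faceHom ι) σ) a = tropCell σ (Function.extend ι a 0) := by
  obtain ⟨P⟩ := σ
  obtain ⟨f, hf, h⟩ := isFace_face ι P
  change tropPoint (face ι P).graph (a ∘ (face ι P).τ)
    = tropPoint P.graph (Function.extend ι a 0 ∘ P.τ)
  rw [← extend_conj h, tropPoint_extend]

/-- Naturality of `α` in geometric form: this is what makes the action on cells well defined across
face gluings. -/
theorem tropCell_app_of_isFace (α : Delta g n ⟶ Delta g n) {k l : ℕ} {ι : Fin k ↪ Fin l}
    {P : EdgeLabelled g n l} {Q : EdgeLabelled g n k} (h : IsFace ι P Q) (a : Fin k → R) :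
    tropCell (α.app _ (Delta.simplex Q)) a
      = tropCell (α.app _ (Delta.simplex P)) (Function.extend ι a 0) := by
  rw [← tropCell_map, ← simplex_of_isFace h]
  congr 1
  exact NatTrans.naturality_apply α (faceHom ι) (Delta.simplex P)

/-- An arbitrary labelling of the edges of a stable graph. -/
noncomputable def edgeEquiv (G : StableGraph g n) : G.E ≃ Fin (Fintype.card G.E) :=
  Fintype.equivFin _

/-- A stable graph with an arbitrary labelling of its edges. -/
noncomputable def labelled (G : StableGraph g n) : EdgeLabelled g n (Fintype.card G.E) :=
  ⟨G, edgeEquiv G⟩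

theorem tropPoint_eq_cell (G : StableGraph g n) (x : G.E → R) :
    tropPoint G x = tropCell (Delta.simplex (labelled G)) (x ∘ (edgeEquiv G).symm) := by
  change _ = tropPoint G ((x ∘ (edgeEquiv G).symm) ∘ edgeEquiv G)
  rw [Function.comp_assoc, Equiv.symm_comp_self, Function.comp_id]

theorem exists_tropCell (p : (tropDiagram g n).Space R) :
    ∃ (k : ℕ) (σ : (Delta g n).obj (op ⟨k⟩)) (a : Fin k → R), tropCell σ a = p := by
  obtain ⟨G, x⟩ := p
  exact ⟨_, _, _, (tropPoint_eq_cell G x).symm⟩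

theorem eq_of_tropCell {Y : Type*} {F F' : (tropDiagram g n).Space R → Y}
    (h : ∀ (k : ℕ) (σ : (Delta g n).obj (op ⟨k⟩)) (a : Fin k → R),
      F (tropCell σ a) = F' (tropCell σ a)) : F = F' := by
  funext p
  obtain ⟨k, σ, a, rfl⟩ := exists_tropCell p
  exact h k σ a

/-! ### The action of endomorphisms of the symmetric Δ-complex -/

/-- The map of the colimit of cones induced by an endomorphism of `Δ_{g,n}`. -/
noncomputable def realize (R : Type) [Zero R] (α : Delta g n ⟶ Delta g n) :
    (tropDiagram g n).Space R → (tropDiagram g n).Space R :=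
  tropLift (fun G x => tropCell (α.app _ (Delta.simplex (labelled G))) (x ∘ (edgeEquiv G).symm)) (by
    intro G G' f hf x
    -- With the chosen labellings, `f` exhibits `labelled G'` as a face of `labelled G` along the
    -- conjugate of `f^*`.
    have hκ := conj_apply hf.pullE (edgeEquiv G') (edgeEquiv G)
    refine Eq.trans ?_ (tropCell_app_of_isFace α (P := labelled G) (Q := labelled G')
      ⟨f, hf, hκ⟩ (x ∘ (edgeEquiv G').symm)).symm
    congr 1
    have h1 := extend_conj hκ (x ∘ (edgeEquiv G').symm)
    rw [Function.comp_assoc, Equiv.symm_comp_self, Function.comp_id] at h1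
    rw [h1, Function.comp_assoc, Equiv.self_comp_symm, Function.comp_id])

theorem realize_point (α : Delta g n ⟶ Delta g n) (G : StableGraph g n) (x : G.E → R) :
    realize R α (tropPoint G x)
      = tropCell (α.app _ (Delta.simplex (labelled G))) (x ∘ (edgeEquiv G).symm) := rfl

/-- Shows that the labelling chosen in `realize` does not matter, and characterizes `realize`, since
the cells cover the colimit. -/
theorem realize_cell (α : Delta g n ⟶ Delta g n) {k : ℕ} (σ : (Delta g n).obj (op ⟨k⟩))
    (a : Fin k → R) : realize R α (tropCell σ a) = tropCell (α.app _ σ) a := by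
  obtain ⟨P⟩ := σ
  change realize R α (tropPoint P.graph (a ∘ P.τ)) = tropCell (α.app _ (Delta.simplex P)) a
  -- The identity of the graph presents `P` as the face of `labelled P.graph` along the permutation
  -- that compares the two labellings.
  have hκ : ∀ e, (edgeEquiv P.graph) ((isIsom_id P.graph).isMor.pullE e) = _ := fun e =>
    (congrArg _ (pullE_id P.graph e)).trans
      (conj_apply (Function.Embedding.refl _) P.τ (edgeEquiv P.graph) e)
  have h1 := extend_conj hκ a
  have h2 : Function.extend (isIsom_id P.graph).isMor.pullE (a ∘ P.τ) 0 = a ∘ P.τ := by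
    funext e
    conv_lhs => rw [← pullE_id P.graph e]
    exact (isIsom_id P.graph).isMor.pullE.injective.extend_apply _ 0 e
  rw [realize_point, tropCell_app_of_isFace α (P := labelled P.graph) (Q := P) ⟨id, _, hκ⟩, ← h2, h1,
    Function.comp_assoc, Equiv.self_comp_symm, Function.comp_id]

theorem realize_id : realize R (𝟙 (Delta g n)) = id :=
  eq_of_tropCell fun _ σ a => realize_cell _ σ a

theorem realize_comp (α β : Delta g n ⟶ Delta g n) :
    realize R (α ≫ β) = realize R β ∘ realize R α :=
  eq_of_tropCell fun _ σ a => by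
    simp only [Function.comp, realize_cell]
    rfl

/-- On each cone the action only renames coordinates; this gives both continuity and the lifts
required of a morphism. -/
theorem realize_lift (α : Delta g n ⟶ Delta g n) (G : StableGraph g n) :
    ∃ (G' : StableGraph g n) (e : G'.E ≃ G.E), ∀ x : G.E → R,
      realize R α (tropPoint G x) = tropPoint G' (x ∘ e) := by
  obtain ⟨Q, hQ⟩ := Quotient.exists_rep (α.app _ (Delta.simplex (labelled G)))
  refine ⟨Q.graph, Q.τ.trans (edgeEquiv G).symm, fun x => ?_⟩
  rw [realize_point, ← hQ]
  rfl

theorem continuous_realize [TopologicalSpace R] (α : Delta g n ⟶ Delta g n) :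
    Continuous (realize R α) := by
  refine continuous_quot_lift _ (continuous_sigma fun G => ?_)
  obtain ⟨G', e, h⟩ := realize_lift (R := R) α G
  have h' : ∀ x : G.E → R, realize R α (tropPoint G x) = Quot.mk _ ⟨G', x ∘ e⟩ := h
  refine Continuous.congr ?_ fun x => (h' x).symm
  exact continuous_quot_mk.comp (continuous_sigmaMk.comp
    (continuous_pi fun i => continuous_apply (e i)))

end Zero

end Space
-- Volume, and rigidity of automorphisms
section Semiring

variable {R : Type} [CommSemiring R]

/-- The map of the colimit of cones is given on every cone by `ℕ`-combinations of coordinates. -/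
def HasNatLifts (F : (tropDiagram g n).Space R → (tropDiagram g n).Space R) : Prop :=
  ∀ G : StableGraph g n, ∃ (G' : StableGraph g n) (A : G'.E → G.E → ℕ), ∀ x : G.E → R,
    F (tropPoint G x) = tropPoint G' fun b => ∑ i, A b i * x i

/-- The sum of the edge lengths. -/
noncomputable def tropVol : (tropDiagram g n).Space R → R :=
  tropLift (fun G x => ∑ e : G.E, x e) (by
    intro G G' f hf x
    classical
    refine (Finset.sum_of_injOn hf.pullE (hf.pullE.injective.injOn) (by simp) ?_ ?_).symm
    · intro e _ he
      by_contra h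
      obtain ⟨a, rfl, -⟩ := (extend_ne_zero_iff _ _ _).1 h
      exact he ⟨a, by simp, rfl⟩
    · exact fun a _ => (hf.pullE.injective.extend_apply x 0 a).symm)

theorem tropVol_point (G : StableGraph g n) (x : G.E → R) : tropVol (tropPoint G x) = ∑ e, x e := rfl

/-- After applying a matrix, the volume depends only on its column sums. -/
theorem tropVol_natLift {G G' : StableGraph g n} (A : G'.E → G.E → ℕ) (x : G.E → R) :
    tropVol (tropPoint G' fun b => ∑ i, (A b i : R) * x i) = ∑ i, ((∑ b, A b i : ℕ) : R) * x i := by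
  rw [tropVol_point, Finset.sum_comm]
  refine Finset.sum_congr rfl fun i _ => ?_
  rw [Nat.cast_sum, Finset.sum_mul]

variable [CharZero R]

open scoped Classical in
-- A zero column would send the unit vector of `i` to the same point as the apex, but these two
-- points have different ranks.
theorem exists_ne_zero_of_injective {F : (tropDiagram g n).Space R → (tropDiagram g n).Space R}
    (hF : Function.Injective F) {G G' : StableGraph g n} {A : G'.E → G.E → ℕ}
    (hA : ∀ x : G.E → R, F (tropPoint G x) = tropPoint G' fun b => ∑ i, A b i * x i) (i : G.E) :
    ∃ b, A b i ≠ 0 := by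
  by_contra! h
  have h1 : tropPoint G (Pi.single i (1 : R)) = tropPoint G 0 := by
    refine hF ?_
    rw [hA, hA]
    congr 1
    funext b
    simp [Pi.single_apply, h]
  have h2 := tropRank_eq_zero.1 ((congrArg tropRank h1).trans (tropRank_eq_zero.2 rfl))
  simpa using congrFun h2 i

/-- The lengths $1, \dots, k$ give a test point in each cell to which `tropCell_injective` applies.
-/
theorem injective_labelling (k : ℕ) : Function.Injective (fun i : Fin k => ((i.1 + 1 : ℕ) : R)) :=
  fun _ _ h => Fin.ext (Nat.succ_injective (Nat.cast_injective (R := R) h))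

theorem labelling_ne_zero (k : ℕ) (i : Fin k) : ((i.1 + 1 : ℕ) : R) ≠ 0 :=
  Nat.cast_ne_zero.2 (Nat.succ_ne_zero _)

theorem eq_of_forall_tropCell {k : ℕ} {σ σ' : (Delta g n).obj (op ⟨k⟩)}
    (h : ∀ a : Fin k → R, tropCell σ a = tropCell σ' a) : σ = σ' :=
  tropCell_injective (injective_labelling k) (labelling_ne_zero k) (h _)

theorem realize_injective {α β : Delta g n ⟶ Delta g n} (h : realize R α = realize R β) : α = β := by
  ext ⟨⟨k⟩⟩ σ
  refine eq_of_forall_tropCell (R := R) fun a => ?_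
  exact (realize_cell α σ a).symm.trans ((congrFun h _).trans (realize_cell β σ a))

variable [PartialOrder R] [IsOrderedRing R] [CanonicallyOrderedAdd R]

/-- Every column sum is a positive integer, so each length contributes at least itself to the volume
of the image. -/
theorem tropVol_le {F : (tropDiagram g n).Space R → (tropDiagram g n).Space R}
    (hF : Function.Injective F) (hl : HasNatLifts F) (p : (tropDiagram g n).Space R) :
    tropVol p ≤ tropVol (F p) := by
  obtain ⟨G, x, rfl⟩ : ∃ (G : StableGraph g n) (x : G.E → R), tropPoint G x = p :=
    ⟨p.exists_rep.choose.1, p.exists_rep.choose.2, p.exists_rep.choose_spec⟩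
  obtain ⟨G', A, hA⟩ := hl G
  rw [hA, tropVol_natLift, tropVol_point]
  refine Finset.sum_le_sum fun i _ => ?_
  obtain ⟨b, hb⟩ := exists_ne_zero_of_injective hF hA i
  have h1 : 1 ≤ ∑ b, A b i :=
    (Nat.one_le_iff_ne_zero.2 hb).trans
      (Finset.single_le_sum (f := fun b => A b i) (fun _ _ => Nat.zero_le _) (Finset.mem_univ b))
  have h2 : (1 : R) ≤ ((∑ b, A b i : ℕ) : R) := by exact_mod_cast Nat.mono_cast (α := R) h1
  exact le_mul_of_one_le_left zero_le h2

/-- An automorphism with integral linear lifts maps every cone onto a cone, permuting the coordinates. -/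
theorem exists_embedding_of_natLifts {F F' : (tropDiagram g n).Space R → (tropDiagram g n).Space R}
    (hl : HasNatLifts F) (hl' : HasNatLifts F') (h1 : ∀ p, F' (F p) = p) (h2 : ∀ p, F (F' p) = p)
    (G : StableGraph g n) : ∃ (G' : StableGraph g n) (f : G.E ↪ G'.E), ∀ x : G.E → R,
      F (tropPoint G x) = tropPoint G' (Function.extend f x 0) := by
  classical
  have hF : Function.Injective F := Function.LeftInverse.injective h1
  have hF' : Function.Injective F' := Function.LeftInverse.injective h2
  have hvol : ∀ p, tropVol (F p) = tropVol p := fun p => by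
    refine le_antisymm ?_ (tropVol_le hF hl p)
    simpa only [h1] using tropVol_le hF' hl' (F p)
  obtain ⟨G', A, hA⟩ := hl G
  -- Compare volumes at a unit vector: its volume is 1 and that of its image is the column sum, so
  -- the equality descends to $\mathbb{N}$ even if `R` contains $\infty$.
  have hcol : ∀ i, ∑ b, A b i = 1 := fun i => by
    have h3 := hvol (tropPoint G (Pi.single i 1))
    rw [hA, tropVol_natLift, tropVol_point] at h3
    have h4 : ∑ c, ((∑ b, A b c : ℕ) : R) * (Pi.single i 1 : G.E → R) c = ((∑ b, A b i : ℕ) : R) := by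
      rw [Finset.sum_eq_single i (fun c _ hc => by rw [Pi.single_eq_of_ne hc, mul_zero]) (by simp),
        Pi.single_eq_same, mul_one]
    rw [h4, Finset.sum_pi_single', if_pos (Finset.mem_univ i)] at h3
    exact Nat.cast_injective (h3.trans Nat.cast_one.symm)
  -- Natural numbers with sum 1 are all zero except for a single 1.
  have hunit : ∀ i, ∃ b, ∀ b', A b' i = if b' = b then 1 else 0 := fun i => by
    obtain ⟨b, hb⟩ := exists_ne_zero_of_injective hF hA i
    have h3 := Finset.add_sum_erase Finset.univ (fun b => A b i) (Finset.mem_univ b)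
    simp only [hcol i] at h3
    refine ⟨b, fun b' => ?_⟩
    split_ifs with hbb
    · subst hbb
      omega
    · have h4 := Finset.single_le_sum (f := fun b => A b i) (s := Finset.univ.erase b)
        (fun _ _ => Nat.zero_le _) (Finset.mem_erase.2 ⟨hbb, Finset.mem_univ b'⟩)
      omega
  choose f hf using hunit
  have hL : ∀ x : G.E → R, F (tropPoint G x) = tropPoint G' fun b => ∑ i with f i = b, x i := by
    intro x
    rw [hA]
    congr 1
    funext b
    rw [Finset.sum_filter]
    refine Finset.sum_congr rfl fun i _ => ?_
    rw [hf]
    by_cases h : f i = b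
    · simp [h]
    · simp [h, Ne.symm h]
  have hinj : Function.Injective f := by
    intro i j hij
    by_contra hne
    -- If columns `i` and `j` coincide, $e_i + e_j$ and $2e_i$ have the same image, yet the first
    -- has rank at least 2 and the second at most 1.
    have h3 : tropPoint G (Pi.single i 1 + Pi.single j 1 : G.E → R)
        = tropPoint G (Pi.single i 2) := by
      refine hF ?_
      rw [hL, hL]
      congr 1
      funext b
      simp only [Pi.add_apply, Finset.sum_add_distrib, Finset.sum_pi_single', Finset.mem_filter,
        Finset.mem_univ, true_and, hij]
      split_ifs
      · exact one_add_one_eq_two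
      · exact add_zero 0
    have h4 := congrArg tropRank h3
    rw [tropRank_point, tropRank_point] at h4
    have h5 : ∀ e, (Pi.single i 2 : G.E → R) e ≠ 0 → e = i := fun e he => by
      by_contra h
      exact he (Pi.single_eq_of_ne h _)
    have h6 : Subsingleton {e // (Pi.single i 2 : G.E → R) e ≠ 0} :=
      ⟨fun a b => Subtype.ext ((h5 _ a.2).trans (h5 _ b.2).symm)⟩
    rw [← Finite.card_le_one_iff_subsingleton, ← h4, Finite.card_le_one_iff_subsingleton] at h6
    have hi : (Pi.single i 1 + Pi.single j 1 : G.E → R) i ≠ 0 := by simp [Pi.single_eq_of_ne hne]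
    have hj : (Pi.single i 1 + Pi.single j 1 : G.E → R) j ≠ 0 := by
      simp [Pi.single_eq_of_ne (Ne.symm hne)]
    exact hne (congrArg Subtype.val (h6.elim ⟨i, hi⟩ ⟨j, hj⟩))
  refine ⟨G', ⟨f, hinj⟩, fun x => ?_⟩
  rw [hL]
  congr 1
  funext b
  by_cases hb : ∃ a, f a = b
  · obtain ⟨a, rfl⟩ := hb
    refine Eq.trans ?_ (hinj.extend_apply x 0 a).symm
    rw [Finset.sum_filter]
    simp [hinj.eq_iff]
  · refine Eq.trans ?_ (Function.extend_apply' _ _ _ hb).symm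
    refine Finset.sum_eq_zero fun i hi => ?_
    exact (hb ⟨i, (Finset.mem_filter.1 hi).2⟩).elim

/-! ### From automorphisms of the colimit to automorphisms of the symmetric Δ-complex -/

theorem exists_tropCell_of_natLifts {F F' : (tropDiagram g n).Space R → (tropDiagram g n).Space R}
    (hl : HasNatLifts F) (hl' : HasNatLifts F') (h1 : ∀ p, F' (F p) = p) (h2 : ∀ p, F (F' p) = p)
    {k : ℕ} (σ : (Delta g n).obj (op ⟨k⟩)) :
    ∃ σ' : (Delta g n).obj (op ⟨k⟩), ∀ a : Fin k → R, F (tropCell σ a) = tropCell σ' a := by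
  obtain ⟨P⟩ := σ
  obtain ⟨G', f, hf⟩ := exists_embedding_of_natLifts hl hl' h1 h2 P.graph
  -- The image simplex is the face of `G'` whose surviving edges are those in the range of `f`,
  -- labelled through `f` by `P.τ`.
  refine ⟨(Delta g n).map (faceHom ((P.τ.symm.toEmbedding.trans f).trans (edgeEquiv G').toEmbedding))
    (Delta.simplex (labelled G')), fun a => ?_⟩
  rw [tropCell_map]
  change F (tropPoint P.graph (a ∘ P.τ)) = tropPoint G' _
  rw [hf, extend_conj (conj_apply f P.τ (edgeEquiv G'))]
  rfl

/-- The simplices chosen cell by cell are natural automatically: both sides of the naturality square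
have cells that agree at all lengths. -/
theorem exists_realize_of_natLifts {F F' : (tropDiagram g n).Space R → (tropDiagram g n).Space R}
    (hl : HasNatLifts F) (hl' : HasNatLifts F') (h1 : ∀ p, F' (F p) = p) (h2 : ∀ p, F (F' p) = p) :
    ∃ α : Delta g n ⟶ Delta g n, realize R α = F := by
  choose α hα using fun k => exists_tropCell_of_natLifts hl hl' h1 h2 (k := k)
  refine ⟨{ app := fun k => ↾(α k.unop.card), naturality := ?_ }, eq_of_tropCell fun k σ a => ?_⟩
  · rintro ⟨⟨l⟩⟩ ⟨⟨k⟩⟩ ι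
    obtain ⟨ι, rfl⟩ : ∃ κ : Fin k ↪ Fin l, faceHom κ = ι := ⟨ι.unop, rfl⟩
    ext σ
    refine eq_of_forall_tropCell (R := R) fun a => ?_
    change tropCell (α k ((Delta g n).map (faceHom ι) σ)) a
      = tropCell ((Delta g n).map (faceHom ι) (α l σ)) a
    rw [← hα, tropCell_map, tropCell_map, hα]
  · rw [realize_cell]
    exact (hα k σ a).symm

/-- The transformations obtained from `F` and `F'` are mutually inverse because `realize` is
faithful and respects composition. -/
theorem exists_iso_realize_of_natLifts {F F' : (tropDiagram g n).Space R → (tropDiagram g n).Space R}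
    (hl : HasNatLifts F) (hl' : HasNatLifts F') (h1 : ∀ p, F' (F p) = p) (h2 : ∀ p, F (F' p) = p) :
    ∃ α : Aut (Delta g n), realize R α.hom = F := by
  obtain ⟨α, hα⟩ := exists_realize_of_natLifts hl hl' h1 h2
  obtain ⟨β, hβ⟩ := exists_realize_of_natLifts hl' hl h2 h1
  refine ⟨⟨α, β, realize_injective (R := R) ?_, realize_injective (R := R) ?_⟩, hα⟩
  · rw [realize_comp, hα, hβ, realize_id]
    exact funext h1
  · rw [realize_comp, hα, hβ, realize_id]
    exact funext h2

end Semiring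

/-! ### Automorphisms of the two tropical moduli spaces -/

theorem exists_natForm_apply {A R : Type} [Fintype A] [CommSemiring R] (i : A) :
    ∃ a : A → ℕ, ∀ x : A → R, x i = ∑ j, a j * x j := by
  classical
  exact ⟨Pi.single i 1, fun x => by simp [Pi.single_apply]⟩

/-- The automorphism of `M^trop_{g,n}` induced by an automorphism of `Δ_{g,n}`. -/
noncomputable def realizeHom (α : Delta g n ⟶ Delta g n) : Mtrop g n ⟶ Mtrop g n :=
  GenConeComplex.Hom.mk (M := Mtrop g n) (N := Mtrop g n) (realize ℝ≥0 α) (continuous_realize α)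
    fun G => by
      obtain ⟨G', e, h⟩ := realize_lift (R := ℝ≥0) α G
      exact ⟨G', fun x => x ∘ e, fun b => exists_natForm_apply (e b), h⟩

/-- The automorphism of the compactification of `M^trop_{g,n}` induced by an automorphism of `Δ_{g,n}`. -/
noncomputable def realizeExtHom (α : Delta g n ⟶ Delta g n) : MtropBar g n ⟶ MtropBar g n :=
  ExtGenConeComplex.Hom.mk (M := MtropBar g n) (N := MtropBar g n) (realize ℝ≥0∞ α)
    (continuous_realize α)
    fun G => by
      obtain ⟨G', e, h⟩ := realize_lift (R := ℝ≥0∞) α G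
      exact ⟨G', fun x => x ∘ e, fun b => .inl (exists_natForm_apply (e b)), h⟩

theorem Mtrop.hom_ext {f f' : Mtrop g n ⟶ Mtrop g n} (h : f.toFun = f'.toFun) : f = f' :=
  GenConeComplex.Hom.ext h

theorem MtropBar.hom_ext {f f' : MtropBar g n ⟶ MtropBar g n} (h : f.toFun = f'.toFun) : f = f' :=
  ExtGenConeComplex.Hom.ext h

theorem Mtrop.hasNatLifts (f : Mtrop g n ⟶ Mtrop g n) : HasNatLifts f.toFun := fun G => by
  obtain ⟨G', L, hL, h⟩ := f.lift G
  choose A hA using hL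
  refine ⟨G', A, fun x => (h x).trans ?_⟩
  exact congrArg (tropPoint G') (funext fun b => hA b x)

/-- Coordinates that are constantly $\infty$ cannot occur: surjectivity forces `f` to fix the apex,
whose representatives on all cones are zero. -/
theorem MtropBar.hasNatLifts {f : MtropBar g n ⟶ MtropBar g n} (hf : Function.Surjective f.toFun) :
    HasNatLifts f.toFun := fun G => by
  -- A lift with value zero somewhere has no constant coordinate $\infty$, so it is linear and
  -- vanishes at zero.
  have zero_of_lift : ∀ {H H' : StableGraph g n} {L : (H.E → ℝ≥0∞) → (H'.E → ℝ≥0∞)},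
      IsExtConeMor L → (∃ x, L x = 0) → L 0 = 0 := by
    rintro H H' L hL ⟨x, hx⟩
    funext b
    rcases hL b with ⟨a, ha⟩ | hb
    · simp [ha]
    · exact (ENNReal.top_ne_zero ((hb x).symm.trans (congrFun hx b))).elim
  -- Choose a preimage of the apex. The lift on its cone takes the value zero there, hence also at
  -- the origin, so `f` sends apex to apex.
  obtain ⟨⟨G₁, x₁⟩, h₁⟩ := hf (tropPoint G 0)
  obtain ⟨G₂, L₂, hL₂, h₂⟩ := f.lift G₁
  have e₁ : tropPoint G₂ (L₂ x₁) = tropPoint G (0 : G.E → ℝ≥0∞) := (h₂ x₁).symm.trans h₁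
  have e₂ : L₂ x₁ = 0 :=
    tropRank_eq_zero.1 ((congrArg tropRank e₁).trans (tropRank_eq_zero.2 rfl))
  have e₃ : f.toFun (tropPoint G 0) = tropPoint G₂ 0 := by
    rw [tropPoint_zero G G₁]
    exact (h₂ 0).trans (congrArg (tropPoint G₂) (zero_of_lift hL₂ ⟨x₁, e₂⟩))
  obtain ⟨G', L, hL, h⟩ := f.lift G
  -- Rank zero detects the apex on every cone, so any lift on the cone of `G` vanishes at the
  -- origin.
  have e₄ : L 0 = 0 := tropRank_eq_zero.1 ((congrArg tropRank ((h 0).symm.trans e₃)).trans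
    (tropRank_eq_zero.2 rfl))
  have hL' : ∀ b, ∃ a : G.E → ℕ, ∀ x, L x b = ∑ i, a i * x i := fun b =>
    (hL b).resolve_right fun hb => ENNReal.top_ne_zero ((hb 0).symm.trans (congrFun e₄ b))
  choose A hA using hL'
  refine ⟨G', A, fun x => (h x).trans ?_⟩
  exact congrArg (tropPoint G') (funext fun b => hA b x)

theorem Mtrop.hom_inv (φ : Aut (Mtrop g n)) (p) : φ.inv.toFun (φ.hom.toFun p) = p :=
  congrFun (congrArg GenConeComplex.Hom.toFun φ.hom_inv_id) p

theorem Mtrop.inv_hom (φ : Aut (Mtrop g n)) (p) : φ.hom.toFun (φ.inv.toFun p) = p :=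
  congrFun (congrArg GenConeComplex.Hom.toFun φ.inv_hom_id) p

theorem MtropBar.hom_inv (φ : Aut (MtropBar g n)) (p) : φ.inv.toFun (φ.hom.toFun p) = p :=
  congrFun (congrArg ExtGenConeComplex.Hom.toFun φ.hom_inv_id) p

theorem MtropBar.inv_hom (φ : Aut (MtropBar g n)) (p) : φ.hom.toFun (φ.inv.toFun p) = p :=
  congrFun (congrArg ExtGenConeComplex.Hom.toFun φ.inv_hom_id) p

theorem realizeHom_comp (α β : Delta g n ⟶ Delta g n) :
    realizeHom (α ≫ β) = realizeHom α ≫ realizeHom β := Mtrop.hom_ext (realize_comp α β)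

theorem realizeHom_id : realizeHom (𝟙 (Delta g n)) = 𝟙 _ := Mtrop.hom_ext realize_id

theorem realizeExtHom_comp (α β : Delta g n ⟶ Delta g n) :
    realizeExtHom (α ≫ β) = realizeExtHom α ≫ realizeExtHom β := MtropBar.hom_ext (realize_comp α β)

theorem realizeExtHom_id : realizeExtHom (𝟙 (Delta g n)) = 𝟙 _ := MtropBar.hom_ext realize_id

/-- The action of `Aut(Δ_{g,n})` on `M^trop_{g,n}`. -/
noncomputable def realizeAut (g n : ℕ) : Aut (Delta g n) →* Aut (Mtrop g n) where
  toFun α := ⟨realizeHom α.hom, realizeHom α.inv,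
    by rw [← realizeHom_comp, α.hom_inv_id, realizeHom_id],
    by rw [← realizeHom_comp, α.inv_hom_id, realizeHom_id]⟩
  map_one' := Iso.ext realizeHom_id
  map_mul' _ _ := Iso.ext (realizeHom_comp _ _)

/-- The action of `Aut(Δ_{g,n})` on the compactification of `M^trop_{g,n}`. -/
noncomputable def realizeExtAut (g n : ℕ) : Aut (Delta g n) →* Aut (MtropBar g n) where
  toFun α := ⟨realizeExtHom α.hom, realizeExtHom α.inv,
    by rw [← realizeExtHom_comp, α.hom_inv_id, realizeExtHom_id],
    by rw [← realizeExtHom_comp, α.inv_hom_id, realizeExtHom_id]⟩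
  map_one' := Iso.ext realizeExtHom_id
  map_mul' _ _ := Iso.ext (realizeExtHom_comp _ _)

theorem realizeAut_bijective (g n : ℕ) : Function.Bijective (realizeAut g n) := by
  constructor
  · intro α β h
    refine Iso.ext (realize_injective (R := ℝ≥0) ?_)
    exact congrArg (fun φ : Aut (Mtrop g n) => φ.hom.toFun) h
  · intro φ
    obtain ⟨α, hα⟩ := exists_iso_realize_of_natLifts (Mtrop.hasNatLifts φ.hom)
      (Mtrop.hasNatLifts φ.inv) (Mtrop.hom_inv φ) (Mtrop.inv_hom φ)
    exact ⟨α, Iso.ext (Mtrop.hom_ext hα)⟩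

theorem realizeExtAut_bijective (g n : ℕ) : Function.Bijective (realizeExtAut g n) := by
  constructor
  · intro α β h
    refine Iso.ext (realize_injective (R := ℝ≥0∞) ?_)
    exact congrArg (fun φ : Aut (MtropBar g n) => φ.hom.toFun) h
  · intro φ
    obtain ⟨α, hα⟩ := exists_iso_realize_of_natLifts
      (MtropBar.hasNatLifts fun p => ⟨φ.inv.toFun p, MtropBar.inv_hom φ p⟩)
      (MtropBar.hasNatLifts fun p => ⟨φ.hom.toFun p, MtropBar.hom_inv φ p⟩)
      (MtropBar.hom_inv φ) (MtropBar.inv_hom φ)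
    exact ⟨α, Iso.ext (MtropBar.hom_ext hα)⟩

/-- `Aut(Δ_{g,n}) ≃ Aut(M^trop_{g,n})`. -/
noncomputable def realizeEquiv (g n : ℕ) : Aut (Delta g n) ≃* Aut (Mtrop g n) :=
  MulEquiv.ofBijective (realizeAut g n) (realizeAut_bijective g n)

/-- `Aut(Δ_{g,n})` is the automorphism group of the compactification of `M^trop_{g,n}`. -/
noncomputable def realizeExtEquiv (g n : ℕ) : Aut (Delta g n) ≃* Aut (MtropBar g n) :=
  MulEquiv.ofBijective (realizeExtAut g n) (realizeExtAut_bijective g n)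

/-! ### Compatibility with the inclusion into the compactification -/

theorem cell_eq_tropCell {k : ℕ} (σ : (Delta g n).obj (op ⟨k⟩)) (a : Fin k → ℝ≥0) :
    Delta.cell σ a = tropCell σ a := by
  obtain ⟨P⟩ := σ
  rfl

theorem incl_tropCell {k : ℕ} (σ : (Delta g n).obj (op ⟨k⟩)) (a : Fin k → ℝ≥0) :
    Mtrop.incl g n (tropCell σ a) = tropCell σ fun i => (a i : ℝ≥0∞) := by
  obtain ⟨P⟩ := σ
  rfl

theorem incl_realize (α : Delta g n ⟶ Delta g n) (x : (Mtrop g n).Points) :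
    realize ℝ≥0∞ α (Mtrop.incl g n x) = Mtrop.incl g n (realize ℝ≥0 α x) := by
  obtain ⟨k, σ, a, rfl⟩ := exists_tropCell x
  rw [realize_cell, incl_tropCell, incl_tropCell, realize_cell]

/-- Gives the uniqueness of `Θ`. The test point with lengths $1, \dots, k$ still has distinct
nonzero lengths in `ℝ≥0∞`, so it determines the simplex there and injectivity of the inclusion is
not needed. -/
theorem realize_hom_injective_of_incl {α β : Delta g n ⟶ Delta g n}
    (h : ∀ x, Mtrop.incl g n (realize ℝ≥0 α x) = Mtrop.incl g n (realize ℝ≥0 β x)) : α = β := by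
  ext ⟨⟨k⟩⟩ σ
  refine tropCell_injective (R := ℝ≥0∞) (a := fun i => (((i.1 + 1 : ℕ) : ℝ≥0) : ℝ≥0∞))
    (fun i j hij => injective_labelling (R := ℝ≥0) k (ENNReal.coe_injective hij))
    (fun i => ENNReal.coe_ne_zero.2 (labelling_ne_zero k i)) ?_
  have := h (tropCell σ fun i => ((i.1 + 1 : ℕ) : ℝ≥0))
  rwa [realize_cell, realize_cell, incl_tropCell, incl_tropCell] at this

end TropModuli

/-! ### The canonical isomorphisms -/

open TropModuli in
theorem lemma1p2 (g n : ℕ) (hgn : 3 < 3 * g + n) :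
    (∃! Θ : Aut (MtropBar g n) ≃* Aut (Mtrop g n), ∀ (ψ : Aut (MtropBar g n)) (x : (Mtrop g n).Points),
      ψ.hom.toFun (Mtrop.incl g n x) = Mtrop.incl g n ((Θ ψ).hom.toFun x)) ∧
    (∃! Ψ : Aut (Mtrop g n) ≃* Aut (Delta g n), ∀ (φ : Aut (Mtrop g n)) (k : ℕ)
      (σ : (Delta g n).obj (op ⟨k⟩)) (a : Fin k → ℝ≥0),
      φ.hom.toFun (Delta.cell σ a) = Delta.cell ((Ψ φ).hom.app (op ⟨k⟩) σ) a) := by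
  constructor
  · refine ⟨(realizeExtEquiv g n).symm.trans (realizeEquiv g n), ?_, ?_⟩
    · intro ψ x
      obtain ⟨α, rfl⟩ := (realizeExtEquiv g n).surjective ψ
      rw [MulEquiv.trans_apply, MulEquiv.symm_apply_apply]
      exact incl_realize α.hom x
    · intro Θ hΘ
      ext1 ψ
      obtain ⟨α, rfl⟩ := (realizeExtEquiv g n).surjective ψ
      rw [MulEquiv.trans_apply, MulEquiv.symm_apply_apply]
      -- Any competing value of `Θ` is itself the action of some `β`; agreement with `α` after
      -- inclusion forces `β = α`.
      obtain ⟨β, hβ⟩ := (realizeEquiv g n).surjective (Θ (realizeExtEquiv g n α))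
      rw [← hβ]
      congr 1
      refine Iso.ext (realize_hom_injective_of_incl fun x => ?_)
      have h := hΘ (realizeExtEquiv g n α) x
      rw [← hβ] at h
      exact h.symm.trans (incl_realize α.hom x)
  · refine ⟨(realizeEquiv g n).symm, ?_, ?_⟩
    · intro φ k σ a
      obtain ⟨α, rfl⟩ := (realizeEquiv g n).surjective φ
      rw [MulEquiv.symm_apply_apply, cell_eq_tropCell, cell_eq_tropCell]
      exact realize_cell α.hom σ a
    · intro Ψ hΨ
      ext1 φ
      obtain ⟨α, rfl⟩ := (realizeEquiv g n).surjective φ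
      rw [MulEquiv.symm_apply_apply]
      refine Iso.ext (realize_injective (R := ℝ≥0) (eq_of_tropCell fun k σ a => ?_))
      have h := hΨ (realizeEquiv g n α) k σ a
      rw [cell_eq_tropCell, cell_eq_tropCell] at h
      rw [realize_cell]
      exact h.symm
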